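/- A torsion-free Type A structure on $\mathbb{R}^3$ is a family of real constants $\Gamma=(\Gamma_{ij}{}^k)_{1\le i,j,k\le 3}$ with $\Gamma_{ij}{}^k=\Gamma_{ji}{}^k$; it defines the connection $\nabla_{\partial_i}\partial_j=\sum_k\Gamma_{ij}{}^k\partial_k$, whose Ricci tensor is $\rho_{jk}=\sum_{i,n}(\Gamma_{in}{}^i\Gamma_{jk}{}^n-\Gamma_{jn}{}^i\Gamma_{ik}{}^n)$. A matrix $T\in\operatorname{GL}(3,\mathbb{R})$ acts by linear change of coordinates, $(T\Gamma)_{ij}{}^k=\sum_{a,b,c}T_{ai}T_{bj}(T^{-1})_{kc}\Gamma_{ab}{}^c$; two structures are linearly equivalent if some $T\in\operatorname{GL}(3,\mathbb{R})$ takes one to the other. Let $G_\Gamma^+=\{T:\det T>0,\ T\Gamma=\Gamma\}$. Put $\operatorname{SO}(1,1)=\{\operatorname{diag}(t,t^{-1},1):t\ne0\}$, and let $\operatorname{SO}(2)$ be the group of rotations about the third coordinate axis. Below, Christoffel symbols are listed up to the symmetry $\Gamma_{ij}{}^k=\Gamma_{ji}{}^k$, and those not listed vanish; parameters are real. **Theorem.**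 Let $\Gamma$ be a torsion-free Type A structure on $\mathbb{R}^3$ with non-degenerate Ricci tensor and $G_\Gamma^+\ne\{\mathrm{id}\}$. Then after a linear change of coordinates with positive determinant, $\Gamma$ is one of the structures in (1), (2), (3), (4a), (4b), with parameters satisfying the stated conditions (and with $G_\Gamma^+\cong\mathbb{Z}_2$ in (4b)). The Ricci tensors are as listed for all values of the parameters, and the assertions on $G_\Gamma^+$ in (1), (2), (3) and (4a) hold for every structure listed there whose parameters satisfy the conditions. 1. $\Gamma_{12}{}^3=a$, $\Gamma_{13}{}^1=b$, $\Gamma_{23}{}^2=c$, $\Gamma_{33}{}^3=d$, and $\rho=ad(e^1\otimes e^2+e^2\otimes e^1)+(-b^2+bd+c(-c+d))\,e^3\otimes e^3$. Conditions: $ad\ne0$ and $-b^2+bd+c(-c+d)\ne0$. Then $G_\Gamma^+=\operatorname{SO}(1,1)$. 2. $\Gamma_{11}{}^3=\Gamma_{22}{}^3=a$, $\Gamma_{13}{}^1=\Gamma_{23}{}^2=b$, $\Gamma_{13}{}^2=c$, $\Gamma_{23}{}^1=-c$, $\Gamma_{33}{}^3=d$, and $\rho=\operatorname{diag}(ad,\,ad,\,2(bd-b^2+c^2))$.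 Conditions: $ad\ne0$ and $bd-b^2+c^2\ne0$. Then $G_\Gamma^+=\operatorname{SO}(2)$. 3. $\Gamma_{11}{}^1=1$, $\Gamma_{12}{}^2=-1$, $\Gamma_{22}{}^1=-1$, $\Gamma_{11}{}^3=\Gamma_{22}{}^3=a$, $\Gamma_{13}{}^1=\Gamma_{23}{}^2=b$, $\Gamma_{13}{}^2=c$, $\Gamma_{23}{}^1=-c$, $\Gamma_{33}{}^3=d$, and $\rho=\operatorname{diag}(ad-2,\,ad-2,\,2(bd-b^2+c^2))$. Conditions: $ad-2\ne0$ and $-b^2+c^2+bd\ne0$. Then $G_\Gamma^+$ is finite and contains an element of order $3$, and $G_\Gamma^+\cong\mathbb{Z}_3$ except in the following cases: - (a) $\Gamma$ is linearly equivalent to the structure of this family with $a=b=d=0$, $c=1$; then $G_\Gamma^+\cong s_3$, the symmetric group on $3$ letters. - (b) $\Gamma$ is linearly equivalent to one of the two structures of this family with $c=0$, $a=b=\pm\frac1{\sqrt2}$, $d=\mp\sqrt2$; then $G_\Gamma^+\cong a_4$, the alternating group on $4$ letters. 4. All non-trivial elements of $G_\Gamma^+$ have order $2$, and there are two types: - (a)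 $\Gamma_{12}{}^3=1$, $\Gamma_{13}{}^2=1$, $\Gamma_{23}{}^1=-1$, with $\rho=\operatorname{diag}(-2,2,2)$ and $G_\Gamma^+\cong\mathbb{Z}_2\oplus\mathbb{Z}_2$. - (b) $\Gamma_{11}{}^3=a$, $\Gamma_{12}{}^3=b$, $\Gamma_{13}{}^1=c$, $\Gamma_{13}{}^2=d$, $\Gamma_{22}{}^3=e$, $\Gamma_{23}{}^1=f$, $\Gamma_{23}{}^2=g$, $\Gamma_{33}{}^3=h$, where $\det\rho\ne0$ and $G_\Gamma^+\cong\mathbb{Z}_2$. Here $\rho_{11}=-2bd+a(-c+g+h)$, $\rho_{12}=\rho_{21}=-de-af+bh$, $\rho_{22}=-2bf+e(c-g+h)$, $\rho_{33}=-c^2-2df+ch+g(-g+h)$, and $\rho_{13}=\rho_{31}=\rho_{23}=\rho_{32}=0$. Every structure with symbols of this form has $G_\Gamma^+\ne\{\mathrm{id}\}$. -/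

import Mathlib

noncomputable section

namespace TypeA

/-- Constant Christoffel symbols on `ℝᵐ`: `Γ i j k` is `Γ_{ij}^k`, i.e.
`∇_{∂_i} ∂_j = ∑ k, Γ i j k • ∂_k`.  Such a family is a Type A structure. -/
abbrev Christoffel (m : ℕ) : Type := Fin m → Fin m → Fin m → ℝ

/-- The Type A connection with symbols `Γ` has no torsion. -/
def TorsionFree {m : ℕ} (Γ : Christoffel m) : Prop :=
  ∀ i j k, Γ i j k = Γ j i k

/-- The curvature `R_{ijk}^l` of the connection, `R(∂_i, ∂_j) ∂_k = ∑ l, R_{ijk}^l • ∂_l` with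
`R(ξ, η) = ∇_ξ ∇_η - ∇_η ∇_ξ - ∇_[ξ, η]`.  The symbols are constant, so that the terms with
derivatives of `Γ` are absent. -/
def curvature {m : ℕ} (Γ : Christoffel m) (i j k l : Fin m) : ℝ :=
  ∑ n, (Γ i n l * Γ j k n - Γ j n l * Γ i k n)

/-- The Ricci tensor `ρ_{jk} = ∑ i, R_{ijk}^i`, i.e. `ρ(ξ, η)` is the trace of
`ζ ↦ R(ζ, ξ) η`. -/
def ricci {m : ℕ} (Γ : Christoffel m) : Matrix (Fin m) (Fin m) ℝ :=
  Matrix.of fun j k => ∑ i, curvature Γ i j k i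

/-- The linear change of coordinates `T`: the symbols of `Γ` in the basis
`T e_i = ∑ a, T a i • e_a`, whose dual basis is `T e^k = ∑ c, T⁻¹ k c • e^c`; that is
`(TΓ)(e_i, e_j, e^k) = Γ(T e_i, T e_j, T e^k)`. -/
def pullback {m : ℕ} (T : GL (Fin m) ℝ) (Γ : Christoffel m) : Christoffel m :=
  fun i j k => ∑ a, ∑ b, ∑ c,
    (T : Matrix (Fin m) (Fin m) ℝ) a i * (T : Matrix (Fin m) (Fin m) ℝ) b j *
      ((T⁻¹ : GL (Fin m) ℝ) : Matrix (Fin m) (Fin m) ℝ) k c * Γ a b c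

theorem pullback_one {m : ℕ} (Γ : Christoffel m) : pullback 1 Γ = Γ := by
  funext i j k
  simp [pullback, Matrix.one_apply]

theorem pullback_mul {m : ℕ} (S T : GL (Fin m) ℝ) (Γ : Christoffel m) :
    pullback (S * T) Γ = pullback T (pullback S Γ) := by
  -- transformation of a single index
  have h1 : ∀ (A B : Matrix (Fin m) (Fin m) ℝ) (i : Fin m) (f : Fin m → ℝ),
      ∑ a, (A * B) a i * f a = ∑ p, B p i * ∑ a, A a p * f a := by
    intro A B i f
    simp only [Matrix.mul_apply, Finset.sum_mul, Finset.mul_sum]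
    rw [Finset.sum_comm]
    refine Finset.sum_congr rfl fun p _ => Finset.sum_congr rfl fun a _ => by ring
  have h2 : ∀ (A B : Matrix (Fin m) (Fin m) ℝ) (k : Fin m) (f : Fin m → ℝ),
      ∑ c, (B * A) k c * f c = ∑ r, B k r * ∑ c, A r c * f c := by
    intro A B k f
    simp only [Matrix.mul_apply, Finset.sum_mul, Finset.mul_sum]
    rw [Finset.sum_comm]
    refine Finset.sum_congr rfl fun p _ => Finset.sum_congr rfl fun a _ => by ring
  -- exchange of two weighted sums
  have h3 : ∀ (x y : Fin m → ℝ) (F : Fin m → Fin m → ℝ),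
      ∑ a, x a * ∑ q, y q * F a q = ∑ q, y q * ∑ a, x a * F a q := by
    intro x y F
    simp only [Finset.mul_sum]
    rw [Finset.sum_comm]
    refine Finset.sum_congr rfl fun p _ => Finset.sum_congr rfl fun a _ => by ring
  have h4 : ∀ (T : GL (Fin m) ℝ) (Γ : Christoffel m) (i j k : Fin m),
      pullback T Γ i j k = ∑ a, (T : Matrix (Fin m) (Fin m) ℝ) a i *
        ∑ b, (T : Matrix (Fin m) (Fin m) ℝ) b j *
          ∑ c, ((T⁻¹ : GL (Fin m) ℝ) : Matrix (Fin m) (Fin m) ℝ) k c * Γ a b c := by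
    intro T Γ i j k
    simp only [pullback, Finset.mul_sum, mul_assoc]
  funext i j k
  simp only [h4, mul_inv_rev, Units.val_mul]
  simp only [h1, h2]
  refine Finset.sum_congr rfl fun p _ => ?_
  rw [h3]
  congr 1
  refine Finset.sum_congr rfl fun q _ => ?_
  congr 1
  symm
  rw [h3]
  refine Finset.sum_congr rfl fun a _ => ?_
  congr 1
  rw [h3]

/-- The group `G_Γ⁺` of the orientation preserving linear symmetries of the connection. -/
def isotropy {m : ℕ} (Γ : Christoffel m) : Subgroup (GL (Fin m) ℝ) where
  carrier := {T | T ∈ Matrix.GLPos (Fin m) ℝ ∧ pullback T Γ = Γ}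
  one_mem' := ⟨one_mem _, pullback_one Γ⟩
  mul_mem' := by
    rintro S T ⟨hS, hS'⟩ ⟨hT, hT'⟩
    exact ⟨mul_mem hS hT, by rw [pullback_mul, hS', hT']⟩
  inv_mem' := by
    rintro T ⟨hT, hT'⟩
    refine ⟨inv_mem hT, ?_⟩
    have h := pullback_mul T T⁻¹ Γ
    rw [mul_inv_cancel, pullback_one, hT'] at h
    exact h.symm

/-- Two structures on `ℝᵐ` that differ by a linear change of coordinates. -/
def LinearlyEquivalent {m : ℕ} (Γ Γ' : Christoffel m) : Prop :=
  ∃ T : GL (Fin m) ℝ, pullback T Γ = Γ'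

/-- The structure on `ℝ³` whose symbols `Γ_{ij}^k` are the entries `(i, j)` of the `k`-th of
three given matrices. -/
def ofMatrices (A₁ A₂ A₃ : Matrix (Fin 3) (Fin 3) ℝ) : Christoffel 3 :=
  fun i j k => (![A₁, A₂, A₃] : Fin 3 → Matrix (Fin 3) (Fin 3) ℝ) k i j

/-- `Γ_{12}^3 = a`, `Γ_{13}^1 = b`, `Γ_{23}^2 = c`, `Γ_{33}^3 = d`. -/
def hyperbolicModel (a b c d : ℝ) : Christoffel 3 :=
  ofMatrices
    !![0, 0, b; 0, 0, 0; b, 0, 0]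
    !![0, 0, 0; 0, 0, c; 0, c, 0]
    !![0, a, 0; a, 0, 0; 0, 0, d]

/-- `Γ_{11}^3 = Γ_{22}^3 = a`, `Γ_{13}^1 = Γ_{23}^2 = b`, `Γ_{13}^2 = c`, `Γ_{23}^1 = -c`,
`Γ_{33}^3 = d`. -/
def rotationModel (a b c d : ℝ) : Christoffel 3 :=
  ofMatrices
    !![0, 0, b; 0, 0, -c; b, -c, 0]
    !![0, 0, c; 0, 0, b; c, b, 0]
    !![a, 0, 0; 0, a, 0; 0, 0, d]

/-- The symbols of `rotationModel a b c d` together with `Γ_{11}^1 = 1`, `Γ_{12}^2 = -1`,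
`Γ_{22}^1 = -1`. -/
def orderThreeModel (a b c d : ℝ) : Christoffel 3 :=
  ofMatrices
    !![1, 0, b; 0, -1, -c; b, -c, 0]
    !![0, -1, c; -1, 0, b; c, b, 0]
    !![a, 0, 0; 0, a, 0; 0, 0, d]

/-- `Γ_{12}^3 = 1`, `Γ_{13}^2 = 1`, `Γ_{23}^1 = -1`. -/
def kleinModel : Christoffel 3 :=
  ofMatrices
    !![0, 0, 0; 0, 0, -1; 0, -1, 0]
    !![0, 0, 1; 0, 0, 0; 1, 0, 0]
    !![0, 1, 0; 1, 0, 0; 0, 0, 0]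

/-- `Γ_{11}^3 = a`, `Γ_{12}^3 = b`, `Γ_{13}^1 = c`, `Γ_{13}^2 = d`, `Γ_{22}^3 = e`,
`Γ_{23}^1 = f`, `Γ_{23}^2 = g`, `Γ_{33}^3 = h`. -/
def orderTwoModel (a b c d e f g h : ℝ) : Christoffel 3 :=
  ofMatrices
    !![0, 0, c; 0, 0, f; c, f, 0]
    !![0, 0, d; 0, 0, g; d, g, 0]
    !![a, b, 0; b, e, 0; 0, 0, h]

/-- The group `SO(1,1)` of the maps `diag(t, t⁻¹, 1)`, `t ≠ 0`. -/
def SO11 : Set (GL (Fin 3) ℝ) :=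
  {T | ∃ t : ℝ, t ≠ 0 ∧
    (T : Matrix (Fin 3) (Fin 3) ℝ) = !![t, 0, 0; 0, t⁻¹, 0; 0, 0, 1]}

/-- The group `SO(2)` of the rotations about the third axis. -/
def SO2 : Set (GL (Fin 3) ℝ) :=
  {T | ∃ θ : ℝ, (T : Matrix (Fin 3) (Fin 3) ℝ) =
    !![Real.cos θ, Real.sin θ, 0; -Real.sin θ, Real.cos θ, 0; 0, 0, 1]}

end TypeA

end

namespace TypeA

open Matrix

/-! ### Tensoriality of the product, the trace form and the Ricci tensor -/

variable {m : ℕ}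

/-! A symmetry T of Γ preserves the Ricci tensor ρ, a non-degenerate symmetric form because Γ has no
torsion. Its determinant is positive, hence 1, and in dimension three such an isometry fixes a
non-zero vector (`exists_fixed_vector`). If T ≠ 1, this vector is not null: otherwise T would be a
full unipotent Jordan block, and invariance under it kills an entry of ρ that has to be non-zero
(`nonnull_of_fixed`). So T splits off an axis and acts on the orthogonal plane as diag(t, 1/t) or as
a rotation (`exists_conj_normal_form`).

For the normal forms, Γ is decomposed into weight spaces of T. If T² ≠ 1, the symbols of weight zero
survive, which gives families 1 and 2. For a rotation a part of weight three may survive too: on the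
plane, viewed as ℂ, it is the product κ z̄ w̄, and a similarity normalises κ ≠ 0 to 1, which gives
family 3. If all symmetries are involutions, one half turn gives the form 4b. A second one commutes
with it, and simultaneous diagonalisation leaves Γ_12^3 = p, Γ_13^2 = q, Γ_23^1 = r with pqr ≠ 0.
Rescaling turns p, q, r into signs. Equal signs would allow a symmetry of order three; all other
signs give 4a.

For the groups in families 1 to 3, two more invariants are used: the trace form ω, and the
antisymmetrised derivative of ρ, which the volume form turns into an endomorphism commuting with
every symmetry (`commute_of_cotton`). In these families ω is a multiple of e^3. If ω ≠ 0, then ω and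
ρ determine the third axis; if ω = 0, the endomorphism does so together with ρ, except on the curve
c = 0, d = -2b, 2ab = 1 of family 3. There Γ is the structure p = q = r = 1 seen along a threefold
axis (`linearlyEquivalent_crossModel`), and its symmetries permute the four non-zero idempotents of
x ∘ y = ∇_x y, the vertices of a tetrahedron. The group s₃ arises in the same way from three
idempotents. -/

/-- The matrix of `x ↦ ∇_{∂_i} x` on constant vector fields. -/
def leftMul (Γ : Christoffel m) (i : Fin m) : Matrix (Fin m) (Fin m) ℝ :=
  Matrix.of fun k n => Γ i n k

/-- The matrix of `x ↦ ∇_x ∂_i` on constant vector fields. -/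
def rightMul (Γ : Christoffel m) (i : Fin m) : Matrix (Fin m) (Fin m) ℝ :=
  Matrix.of fun k n => Γ n i k

/-- The trace form `ω_i = ∑ n, Γ_{ni}^n`. -/
def traceForm (Γ : Christoffel m) (i : Fin m) : ℝ := (rightMul Γ i).trace

/-- The product of constant vector fields, `x ∘ y = ∇_x y`. -/
def product (Γ : Christoffel m) (x y : Fin m → ℝ) : Fin m → ℝ :=
  fun k => ∑ i, ∑ j, x i * y j * Γ i j k

theorem pullback_apply (T : GL (Fin m) ℝ) (Γ : Christoffel m) (i j : Fin m) :
    pullback T Γ i j = ((T⁻¹ : GL (Fin m) ℝ) : Matrix (Fin m) (Fin m) ℝ) *ᵥ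
      product Γ (T.1.col i) (T.1.col j) := by
  funext k
  simp only [pullback, product, Matrix.mulVec, dotProduct, Finset.mul_sum, Matrix.col_apply]
  symm
  rw [Finset.sum_comm]
  refine Finset.sum_congr rfl fun a _ => ?_
  rw [Finset.sum_comm]
  refine Finset.sum_congr rfl fun b _ => Finset.sum_congr rfl fun c _ => by ring

/-- Multiplying by T removes the inverse matrix, so that invariance becomes a system of polynomial
equations in the entries of T. -/
theorem pullback_eq_iff (T : GL (Fin m) ℝ) (Γ Γ' : Christoffel m) :
    pullback T Γ = Γ' ↔ ∀ i j, product Γ (T.1.col i) (T.1.col j) = T.1 *ᵥ Γ' i j := by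
  have h1 : T.1 * ((T⁻¹ : GL (Fin m) ℝ) : Matrix (Fin m) (Fin m) ℝ) = 1 := T.mul_inv
  have h2 : ((T⁻¹ : GL (Fin m) ℝ) : Matrix (Fin m) (Fin m) ℝ) * T.1 = 1 := T.inv_mul
  constructor
  · rintro rfl i j
    rw [pullback_apply, Matrix.mulVec_mulVec, h1, Matrix.one_mulVec]
  · intro h
    funext i j
    rw [pullback_apply, h, Matrix.mulVec_mulVec, h2, Matrix.one_mulVec]

theorem product_sum_left (Γ : Christoffel m) (c : Fin m → ℝ) (f : Fin m → Fin m → ℝ)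
    (y : Fin m → ℝ) : product Γ (∑ i, c i • f i) y = ∑ i, c i • product Γ (f i) y := by
  funext k
  simp only [product, Finset.sum_apply, Pi.smul_apply, smul_eq_mul, Finset.sum_mul,
    Finset.mul_sum]
  symm
  rw [Finset.sum_comm]
  refine Finset.sum_congr rfl fun a _ => ?_
  rw [Finset.sum_comm]
  refine Finset.sum_congr rfl fun b _ => Finset.sum_congr rfl fun c _ => by ring

theorem product_sum_right (Γ : Christoffel m) (c : Fin m → ℝ) (f : Fin m → Fin m → ℝ)
    (y : Fin m → ℝ) : product Γ y (∑ i, c i • f i) = ∑ i, c i • product Γ y (f i) := by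
  funext k
  simp only [product, Finset.sum_apply, Pi.smul_apply, smul_eq_mul, Finset.sum_mul,
    Finset.mul_sum]
  symm
  rw [Finset.sum_comm]
  refine Finset.sum_congr rfl fun a _ => ?_
  rw [Finset.sum_comm]
  refine Finset.sum_congr rfl fun b _ => Finset.sum_congr rfl fun c _ => by ring

theorem mulVec_eq_sum_col (M : Matrix (Fin m) (Fin m) ℝ) (x : Fin m → ℝ) :
    M *ᵥ x = ∑ i, x i • M.col i := by
  funext k
  simp [Matrix.mulVec, dotProduct, mul_comm]

theorem product_eq_sum (Γ : Christoffel m) (x y : Fin m → ℝ) :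
    product Γ x y = ∑ i, x i • ∑ j, y j • Γ i j := by
  funext k
  simp [product, Finset.mul_sum, mul_assoc]

/-- A linear change of coordinates is an isomorphism of algebras. -/
theorem product_pullback (T : GL (Fin m) ℝ) (Γ : Christoffel m) (x y : Fin m → ℝ) :
    product Γ (T.1 *ᵥ x) (T.1 *ᵥ y) = T.1 *ᵥ product (pullback T Γ) x y := by
  have h := (pullback_eq_iff T Γ _).1 rfl
  rw [mulVec_eq_sum_col, mulVec_eq_sum_col, product_sum_left, product_eq_sum (pullback T Γ),
    Matrix.mulVec_sum]
  refine Finset.sum_congr rfl fun i _ => ?_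
  rw [product_sum_right, Matrix.mulVec_smul, Matrix.mulVec_sum]
  congr 1
  refine Finset.sum_congr rfl fun j _ => ?_
  rw [h, Matrix.mulVec_smul]

theorem leftMul_pullback (T : GL (Fin m) ℝ) (Γ : Christoffel m) (j : Fin m) :
    leftMul (pullback T Γ) j =
      ((T⁻¹ : GL (Fin m) ℝ) : Matrix (Fin m) (Fin m) ℝ) * (∑ a, T.1 a j • leftMul Γ a) * T.1 := by
  ext k n
  simp only [leftMul, Matrix.of_apply, pullback, Matrix.mul_apply, Matrix.sum_apply,
    Matrix.smul_apply, smul_eq_mul, Finset.sum_mul, Finset.mul_sum]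
  rw [Finset.sum_comm]
  refine Finset.sum_congr rfl fun a _ => ?_
  rw [Finset.sum_comm]
  rw [Finset.sum_comm]
  refine Finset.sum_congr rfl fun b _ => Finset.sum_congr rfl fun c _ => by ring

theorem rightMul_pullback (T : GL (Fin m) ℝ) (Γ : Christoffel m) (j : Fin m) :
    rightMul (pullback T Γ) j =
      ((T⁻¹ : GL (Fin m) ℝ) : Matrix (Fin m) (Fin m) ℝ) * (∑ a, T.1 a j • rightMul Γ a) *
        T.1 := by
  ext k n
  simp only [rightMul, Matrix.of_apply, pullback, Matrix.mul_apply, Matrix.sum_apply,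
    Matrix.smul_apply, smul_eq_mul, Finset.sum_mul, Finset.mul_sum]
  refine Finset.sum_congr rfl fun a _ => ?_
  refine Finset.sum_congr rfl fun b _ => Finset.sum_congr rfl fun c _ => by ring

theorem traceForm_pullback (T : GL (Fin m) ℝ) (Γ : Christoffel m) (j : Fin m) :
    traceForm (pullback T Γ) j = ∑ a, T.1 a j * traceForm Γ a := by
  have h1 : T.1 * ((T⁻¹ : GL (Fin m) ℝ) : Matrix (Fin m) (Fin m) ℝ) = 1 := T.mul_inv
  rw [traceForm, rightMul_pullback, Matrix.mul_assoc, Matrix.trace_mul_comm, Matrix.mul_assoc,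
    h1, Matrix.mul_one, Matrix.trace_sum]
  simp [traceForm, Matrix.trace_smul]

/-- Both terms are tensorial by themselves: the trace form evaluated on a product, and the trace of
a composition. Equivariance and symmetry of the Ricci tensor are read off from this splitting. -/
theorem ricci_apply (Γ : Christoffel m) (j k : Fin m) :
    ricci Γ j k = ∑ n, traceForm Γ n * Γ j k n - (leftMul Γ j * rightMul Γ k).trace := by
  simp only [ricci, Matrix.of_apply, curvature, Finset.sum_sub_distrib, traceForm, Matrix.trace,
    Matrix.diag, Matrix.mul_apply, leftMul, rightMul, Finset.sum_mul]
  rw [Finset.sum_comm]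

theorem ricci_pullback (T : GL (Fin m) ℝ) (Γ : Christoffel m) :
    ricci (pullback T Γ) = T.1ᵀ * ricci Γ * T.1 := by
  have h1 : T.1 * ((T⁻¹ : GL (Fin m) ℝ) : Matrix (Fin m) (Fin m) ℝ) = 1 := T.mul_inv
  have hA : ∀ j k, ∑ n, traceForm (pullback T Γ) n * pullback T Γ j k n =
      ∑ a, ∑ b, T.1 a j * T.1 b k * ∑ n, traceForm Γ n * Γ a b n := by
    intro j k
    have h := (pullback_eq_iff T Γ _).1 rfl j k
    calc ∑ n, traceForm (pullback T Γ) n * pullback T Γ j k n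
        = ∑ a, traceForm Γ a * (T.1 *ᵥ pullback T Γ j k) a := by
          simp only [traceForm_pullback, Matrix.mulVec, dotProduct, Finset.sum_mul,
            Finset.mul_sum]
          rw [Finset.sum_comm]
          refine Finset.sum_congr rfl fun b _ => Finset.sum_congr rfl fun c _ => by ring
      _ = _ := by
          rw [← h]
          simp only [product, Finset.mul_sum, Matrix.col_apply]
          rw [Finset.sum_comm]
          refine Finset.sum_congr rfl fun a _ => ?_
          rw [Finset.sum_comm]
          refine Finset.sum_congr rfl fun b _ => Finset.sum_congr rfl fun c _ => by ring
  have hB : ∀ j k, (leftMul (pullback T Γ) j * rightMul (pullback T Γ) k).trace =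
      ∑ a, ∑ b, T.1 a j * T.1 b k * (leftMul Γ a * rightMul Γ b).trace := by
    intro j k
    rw [leftMul_pullback, rightMul_pullback]
    set A := ∑ a, T.1 a j • leftMul Γ a with hA
    set B := ∑ a, T.1 a k • rightMul Γ a with hB
    have : ((T⁻¹ : GL (Fin m) ℝ) : Matrix (Fin m) (Fin m) ℝ) * A * T.1 *
        (((T⁻¹ : GL (Fin m) ℝ) : Matrix (Fin m) (Fin m) ℝ) * B * T.1) =
        ((T⁻¹ : GL (Fin m) ℝ) : Matrix (Fin m) (Fin m) ℝ) * ((A * B) * T.1) := by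
      simp only [Matrix.mul_assoc]
      rw [← Matrix.mul_assoc T.1, h1, Matrix.one_mul]
    rw [this, Matrix.trace_mul_comm, Matrix.mul_assoc, h1, Matrix.mul_one, hA, hB,
      Finset.sum_mul, Matrix.trace_sum]
    refine Finset.sum_congr rfl fun a _ => ?_
    rw [Finset.mul_sum, Matrix.trace_sum]
    refine Finset.sum_congr rfl fun b _ => ?_
    rw [Matrix.smul_mul, Matrix.mul_smul, Matrix.trace_smul, Matrix.trace_smul]
    simp only [smul_eq_mul]
    ring
  ext j k
  rw [ricci_apply, hA, hB, ← Finset.sum_sub_distrib]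
  simp only [Matrix.mul_apply, Matrix.transpose_apply, Finset.sum_mul]
  rw [Finset.sum_comm]
  simp only [← Finset.sum_sub_distrib]
  rw [Finset.sum_comm]
  symm
  rw [Finset.sum_comm]
  refine Finset.sum_congr rfl fun a _ => Finset.sum_congr rfl fun b _ => ?_
  rw [ricci_apply]
  ring

theorem TorsionFree.pullback {Γ : Christoffel m} (h : TorsionFree Γ) (T : GL (Fin m) ℝ) :
    TorsionFree (pullback T Γ) := by
  intro i j k
  simp only [TypeA.pullback]
  rw [Finset.sum_comm]
  refine Finset.sum_congr rfl fun a _ => Finset.sum_congr rfl fun b _ =>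
    Finset.sum_congr rfl fun c _ => ?_
  rw [h a b c]
  ring

/-- Without torsion left and right multiplications agree, and the trace of a composition is
symmetric. -/
theorem ricci_symm {Γ : Christoffel m} (h : TorsionFree Γ) (j k : Fin m) :
    ricci Γ j k = ricci Γ k j := by
  have h' : ∀ i, leftMul Γ i = rightMul Γ i := by
    intro i
    ext a b
    exact h _ _ _
  rw [ricci_apply, ricci_apply, ← h' k, ← h' j, Matrix.trace_mul_comm]
  simp only [h j k]

/-! ### Invariants of symmetries, and conjugation -/

theorem mem_isotropy {Γ : Christoffel m} {T : GL (Fin m) ℝ} :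
    T ∈ isotropy Γ ↔ 0 < T.1.det ∧ pullback T Γ = Γ := Iff.rfl

theorem ricci_isotropy {Γ : Christoffel m} {T : GL (Fin m) ℝ} (hT : T ∈ isotropy Γ) :
    T.1ᵀ * ricci Γ * T.1 = ricci Γ := by
  rw [← ricci_pullback, hT.2]

theorem traceForm_isotropy {Γ : Christoffel m} {T : GL (Fin m) ℝ} (hT : T ∈ isotropy Γ)
    (j : Fin m) : ∑ a, T.1 a j * traceForm Γ a = traceForm Γ j := by
  rw [← traceForm_pullback, hT.2]

theorem product_isotropy {Γ : Christoffel m} {T : GL (Fin m) ℝ} (hT : T ∈ isotropy Γ)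
    (x y : Fin m → ℝ) :
    product Γ (T.1 *ᵥ x) (T.1 *ᵥ y) = T.1 *ᵥ product Γ x y := by
  rw [product_pullback, hT.2]

theorem isotropy_apply {Γ : Christoffel m} {T : GL (Fin m) ℝ} (hT : T ∈ isotropy Γ)
    (i j k : Fin m) :
    ∑ a, ∑ b, T.1 a i * T.1 b j * Γ a b k = ∑ n, T.1 k n * Γ i j n :=
  congrFun ((pullback_eq_iff T Γ Γ).1 hT.2 i j) k

/-- Determinants in TᵀρT = ρ give (det T)² = 1, and the orientation selects the root 1. -/
theorem det_isotropy {Γ : Christoffel m} (hΓ : (ricci Γ).det ≠ 0) {T : GL (Fin m) ℝ}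
    (hT : T ∈ isotropy Γ) : T.1.det = 1 := by
  have h := congrArg Matrix.det (ricci_isotropy hT)
  rw [Matrix.det_mul, Matrix.det_mul, Matrix.det_transpose] at h
  have hpos : 0 < T.1.det := hT.1
  have h2 : (T.1.det - 1) * (T.1.det + 1) = 0 := by
    apply mul_right_cancel₀ hΓ
    linear_combination h
  rcases mul_eq_zero.1 h2 with h3 | h3 <;> linarith

theorem conj_mem_isotropy_pullback {Γ : Christoffel m} (P : GL (Fin m) ℝ) {T : GL (Fin m) ℝ} :
    P⁻¹ * T * P ∈ isotropy (pullback P Γ) ↔ T ∈ isotropy Γ := by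
  have hdet : (P⁻¹ * T * P).1.det = T.1.det := by
    have h1 : ((P⁻¹ : GL (Fin m) ℝ) : Matrix (Fin m) (Fin m) ℝ).det * P.1.det = 1 := by
      rw [← Matrix.det_mul, ← Matrix.det_one (n := Fin m)]
      exact congrArg Matrix.det P.inv_mul
    simp only [Units.val_mul, Matrix.det_mul]
    linear_combination T.1.det * h1
  rw [mem_isotropy, mem_isotropy, hdet]
  refine and_congr_right fun _ => ?_
  rw [← pullback_mul, mul_assoc, mul_inv_cancel_left, pullback_mul]
  constructor
  · intro h
    have h2 := congrArg (pullback P⁻¹) h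
    simpa [← pullback_mul, pullback_one] using h2
  · intro h
    rw [h]

/-- The isotropy groups of linearly equivalent structures are conjugate. -/
theorem LinearlyEquivalent.nonempty_mulEquiv {Γ Γ' : Christoffel m}
    (h : LinearlyEquivalent Γ Γ') : Nonempty (isotropy Γ ≃* isotropy Γ') := by
  obtain ⟨P, rfl⟩ := h
  have hmap : (isotropy Γ).map (MulAut.conj P⁻¹).toMonoidHom = isotropy (pullback P Γ) := by
    ext T
    simp only [Subgroup.mem_map]
    constructor
    · rintro ⟨S, hS, rfl⟩
      simpa using (conj_mem_isotropy_pullback P).2 hS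
    · intro hT
      refine ⟨P * T * P⁻¹, ?_, by simp [mul_assoc]⟩
      rw [← conj_mem_isotropy_pullback P]
      simpa [mul_assoc] using hT
  exact ⟨((MulAut.conj P⁻¹).subgroupMap (isotropy Γ)).trans (MulEquiv.subgroupCongr hmap)⟩

theorem LinearlyEquivalent.symm {Γ Γ' : Christoffel m} (h : LinearlyEquivalent Γ Γ') :
    LinearlyEquivalent Γ' Γ := by
  obtain ⟨P, rfl⟩ := h
  exact ⟨P⁻¹, by rw [← pullback_mul, mul_inv_cancel, pullback_one]⟩

theorem LinearlyEquivalent.trans {Γ Γ' Γ'' : Christoffel m} (h : LinearlyEquivalent Γ Γ')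
    (h' : LinearlyEquivalent Γ' Γ'') : LinearlyEquivalent Γ Γ'' := by
  obtain ⟨P, rfl⟩ := h
  obtain ⟨Q, rfl⟩ := h'
  exact ⟨P * Q, pullback_mul _ _ _⟩

/-! ### Isometries of a non-degenerate form on ℝ³ -/

/-- The invertible matrix with three given columns. -/
def ofColumns (u v w : Fin 3 → ℝ) : Matrix (Fin 3) (Fin 3) ℝ := (Matrix.of ![u, v, w])ᵀ

theorem det_ofColumns (u v w : Fin 3 → ℝ) : (ofColumns u v w).det = u ⬝ᵥ v ⨯₃ w := by
  rw [ofColumns, Matrix.det_transpose, triple_product_eq_det]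
  rfl

theorem transpose_mul_mul_apply (R P : Matrix (Fin 3) (Fin 3) ℝ) (i j : Fin 3) :
    (Pᵀ * R * P) i j = P.col i ⬝ᵥ R *ᵥ P.col j := by
  rw [Matrix.mul_assoc]
  simp only [Matrix.mul_apply, dotProduct, Matrix.mulVec, Matrix.col_apply,
    Matrix.transpose_apply]

theorem form_symm {R : Matrix (Fin 3) (Fin 3) ℝ} (hR : R.IsSymm) (x y : Fin 3 → ℝ) :
    x ⬝ᵥ R *ᵥ y = y ⬝ᵥ R *ᵥ x := by
  rw [Matrix.dotProduct_mulVec, dotProduct_comm, ← Matrix.mulVec_transpose, hR.eq]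

/-- An isometry of determinant one of a non-degenerate form on `ℝ³` fixes a vector. -/
theorem exists_fixed_vector {R M : Matrix (Fin 3) (Fin 3) ℝ} (hdet : R.det ≠ 0)
    (hM : Mᵀ * R * M = R) (hM1 : M.det = 1) : ∃ v, v ≠ 0 ∧ M *ᵥ v = v := by
  -- In odd dimension the determinants of the two sides have opposite signs, so det(M - 1) = 0.
  have h : Mᵀ * R * (M - 1) = -((M - 1)ᵀ * R) := by
    rw [Matrix.mul_sub, hM, Matrix.transpose_sub, Matrix.sub_mul]
    simp
  have h0 : (M - 1).det = 0 := by
    have h' := congrArg Matrix.det h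
    rw [Matrix.det_neg, Matrix.det_mul, Matrix.det_mul, Matrix.det_mul, Matrix.det_transpose,
      Matrix.det_transpose, hM1] at h'
    simp only [Fintype.card_fin] at h'
    have : R.det * (2 * (M - 1).det) = 0 := by linear_combination h'
    simpa [hdet] using this
  obtain ⟨v, hv, hv'⟩ := Matrix.exists_mulVec_eq_zero_iff.2 h0
  refine ⟨v, hv, ?_⟩
  rw [Matrix.sub_mulVec, Matrix.one_mulVec] at hv'
  exact sub_eq_zero.1 hv'

theorem exists_form_ne_zero {R : Matrix (Fin 3) (Fin 3) ℝ} (hdet : R.det ≠ 0)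
    {v : Fin 3 → ℝ} (hv : v ≠ 0) : ∃ y, y ⬝ᵥ R *ᵥ v ≠ 0 := by
  by_contra! h
  refine hdet (Matrix.exists_mulVec_eq_zero_iff.1 ⟨v, hv, ?_⟩)
  exact dotProduct_eq_zero_iff.1 fun w => by rw [dotProduct_comm]; exact h w

/-- The orthogonal complement of a non-null vector has a non-null vector. -/
theorem exists_orthogonal_nonnull {R : Matrix (Fin 3) (Fin 3) ℝ} (hR : R.IsSymm)
    (hdet : R.det ≠ 0) {v : Fin 3 → ℝ} (hv : v ⬝ᵥ R *ᵥ v ≠ 0) :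
    ∃ u, u ⬝ᵥ R *ᵥ v = 0 ∧ u ⬝ᵥ R *ᵥ u ≠ 0 := by
  by_contra! h
  -- If all of v^⊥ were null, it would be totally isotropic by polarisation. Its vectors would then
  -- be orthogonal to everything, so v^⊥ = 0 and every vector would be a multiple of v.
  have hpol : ∀ u w, u ⬝ᵥ R *ᵥ v = 0 → w ⬝ᵥ R *ᵥ v = 0 → u ⬝ᵥ R *ᵥ w = 0 := by
    intro u w hu hw
    have h1 := h (u + w) (by rw [add_dotProduct, hu, hw, add_zero])
    rw [Matrix.mulVec_add, add_dotProduct, dotProduct_add, dotProduct_add, h u hu, h w hw,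
      form_symm hR w u] at h1
    linarith
  have hproj : ∀ y, ((v ⬝ᵥ R *ᵥ v) • y - (y ⬝ᵥ R *ᵥ v) • v) ⬝ᵥ R *ᵥ v = 0 := by
    intro y
    rw [sub_dotProduct, smul_dotProduct, smul_dotProduct]
    simp only [smul_eq_mul]
    ring
  have hzero : ∀ u, u ⬝ᵥ R *ᵥ v = 0 → u = 0 := by
    intro u hu
    by_contra hu0
    obtain ⟨y, hy⟩ := exists_form_ne_zero hdet hu0
    have h1 := hpol _ u (hproj y) hu
    rw [sub_dotProduct, smul_dotProduct, smul_dotProduct, form_symm hR v u, hu] at h1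
    simp [hv] at h1
    exact hy h1
  have hpar : ∀ y, (v ⬝ᵥ R *ᵥ v) • y = (y ⬝ᵥ R *ᵥ v) • v := fun y =>
    sub_eq_zero.1 (hzero _ (hproj y))
  by_cases h0 : v 0 = 0
  · have := congrFun (hpar (Pi.single 0 1)) 0
    simp [h0] at this
    exact hv this
  · have h1 := congrFun (hpar (Pi.single 1 1)) 0
    have h2 := congrFun (hpar (Pi.single 1 1)) 1
    simp [h0] at h1
    simp [h1] at h2
    exact hv h2

/-- A basis that is orthogonal for a non-degenerate form and ends with a multiple of a given
non-null vector, with positive orientation. -/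
theorem exists_orthogonal_basis {R : Matrix (Fin 3) (Fin 3) ℝ} (hR : R.IsSymm)
    (hdet : R.det ≠ 0) {v : Fin 3 → ℝ} (hv : v ⬝ᵥ R *ᵥ v ≠ 0) :
    ∃ P : GL (Fin 3) ℝ, 0 < P.1.det ∧ (∃ c : ℝ, P.1.col 2 = c • v) ∧
      ∃ x y z : ℝ, x ≠ 0 ∧ y ≠ 0 ∧ z ≠ 0 ∧ P.1ᵀ * R * P.1 = Matrix.diagonal ![x, y, z] := by
  obtain ⟨u, huv, huu⟩ := exists_orthogonal_nonnull hR hdet hv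
  -- The cross product of the covectors Rv and Ru is a vector orthogonal to v and u for R.
  set w := (R *ᵥ v) ⨯₃ (R *ᵥ u) with hw
  have hwv : w ⬝ᵥ R *ᵥ v = 0 := by rw [dotProduct_comm, hw, dot_self_cross]
  have hwu : w ⬝ᵥ R *ᵥ u = 0 := by rw [dotProduct_comm, hw, dot_cross_self]
  have hvu : v ⬝ᵥ R *ᵥ u = 0 := by rw [form_symm hR, huv]
  have hvw : v ⬝ᵥ R *ᵥ w = 0 := by rw [form_symm hR, hwv]
  have huw : u ⬝ᵥ R *ᵥ w = 0 := by rw [form_symm hR, hwu]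
  have hdetP : ∀ c : ℝ, (ofColumns u w (c • v)).det =
      c * ((u ⬝ᵥ R *ᵥ u) * (v ⬝ᵥ R *ᵥ v)) := by
    intro c
    rw [det_ofColumns, triple_product_permutation, hw, LinearMap.map_smul₂, dotProduct_smul,
      cross_dot_cross, dotProduct_comm (R *ᵥ v) v, dotProduct_comm (R *ᵥ u) u,
      dotProduct_comm (R *ᵥ v) u, huv]
    simp only [smul_eq_mul]
    ring
  obtain ⟨c, hc⟩ : ∃ c : ℝ, 0 < c * ((u ⬝ᵥ R *ᵥ u) * (v ⬝ᵥ R *ᵥ v)) := by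
    -- With this factor the determinant of the basis is a square.
    refine ⟨(u ⬝ᵥ R *ᵥ u) * (v ⬝ᵥ R *ᵥ v), mul_self_pos.2 (mul_ne_zero huu hv)⟩
  have hpos : 0 < (ofColumns u w (c • v)).det := by rw [hdetP]; exact hc
  have hcol0 : (ofColumns u w (c • v)).col 0 = u := rfl
  have hcol1 : (ofColumns u w (c • v)).col 1 = w := rfl
  have hcol2 : (ofColumns u w (c • v)).col 2 = c • v := rfl
  have hD : (ofColumns u w (c • v))ᵀ * R * ofColumns u w (c • v) = Matrix.diagonal
      ![u ⬝ᵥ R *ᵥ u, w ⬝ᵥ R *ᵥ w, (c • v) ⬝ᵥ R *ᵥ (c • v)] := by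
    ext i j
    rw [transpose_mul_mul_apply]
    fin_cases i <;> fin_cases j <;>
      simp [hcol0, hcol1, hcol2, Matrix.mulVec_smul, huv, hvu, hwv, hvw, hwu, huw]
  -- The norm of w is not computed: that the diagonal entries do not vanish follows from the
  -- determinant.
  have hprod := congrArg Matrix.det hD
  rw [Matrix.det_mul, Matrix.det_mul, Matrix.det_transpose, Matrix.det_diagonal,
    Fin.prod_univ_three] at hprod
  have hne : (u ⬝ᵥ R *ᵥ u) * (w ⬝ᵥ R *ᵥ w) * ((c • v) ⬝ᵥ R *ᵥ (c • v)) ≠ 0 := by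
    refine ne_of_eq_of_ne hprod.symm ?_
    exact mul_ne_zero (mul_ne_zero hpos.ne' hdet) hpos.ne'
  refine ⟨Matrix.GeneralLinearGroup.mkOfDetNeZero _ hpos.ne', hpos, ⟨c, rfl⟩, _, _, _,
    left_ne_zero_of_mul (left_ne_zero_of_mul hne), right_ne_zero_of_mul (left_ne_zero_of_mul hne),
    right_ne_zero_of_mul hne, hD⟩

theorem conj_val_eq {P M : GL (Fin 3) ℝ} {N : Matrix (Fin 3) (Fin 3) ℝ}
    (h : M.1 * P.1 = P.1 * N) : (P⁻¹ * M * P).1 = N := by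
  have h2 : ((P⁻¹ : GL (Fin 3) ℝ) : Matrix (Fin 3) (Fin 3) ℝ) * P.1 = 1 := P.inv_mul
  rw [Units.val_mul, Units.val_mul, Matrix.mul_assoc, h, ← Matrix.mul_assoc, h2, Matrix.one_mul]

theorem mul_eq_of_conj {P M : GL (Fin 3) ℝ} : M.1 * P.1 = P.1 * (P⁻¹ * M * P).1 := by
  rw [← Units.val_mul, ← Units.val_mul]
  congr 1
  group

/-- A rotation about the third axis, given by the cosine and the sine of its angle. -/
def rotation (p q : ℝ) : Matrix (Fin 3) (Fin 3) ℝ := !![p, -q, 0; q, p, 0; 0, 0, 1]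

/-- An element of determinant one of the orthogonal group of a form with a non-null fixed vector
is, in a suitable basis, a hyperbolic or an elliptic rotation. -/
theorem exists_conj_of_nonnull_fixed {R : Matrix (Fin 3) (Fin 3) ℝ} (hR : R.IsSymm)
    (hdet : R.det ≠ 0) {M : GL (Fin 3) ℝ} (hM : M.1ᵀ * R * M.1 = R) (hM1 : M.1.det = 1)
    {v : Fin 3 → ℝ} (hv : v ⬝ᵥ R *ᵥ v ≠ 0) (hMv : M.1 *ᵥ v = v) :
    ∃ P : GL (Fin 3) ℝ, 0 < P.1.det ∧
      ((∃ t : ℝ, t ≠ 0 ∧ (P⁻¹ * M * P).1 = !![t, 0, 0; 0, t⁻¹, 0; 0, 0, 1]) ∨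
        ∃ p q : ℝ, p ^ 2 + q ^ 2 = 1 ∧ (P⁻¹ * M * P).1 = rotation p q) := by
  obtain ⟨P, hP, ⟨c, hc⟩, x, y, z, hx, hy, hz, hD⟩ := exists_orthogonal_basis hR hdet hv
  set N := (P⁻¹ * M * P).1 with hN
  have hMP : M.1 * P.1 = P.1 * N := mul_eq_of_conj
  have hPinv : ((P⁻¹ : GL (Fin 3) ℝ) : Matrix (Fin 3) (Fin 3) ℝ) * P.1 = 1 := P.inv_mul
  have hND : Nᵀ * Matrix.diagonal ![x, y, z] * N = Matrix.diagonal ![x, y, z] := by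
    rw [← hD]
    calc Nᵀ * (P.1ᵀ * R * P.1) * N = (P.1 * N)ᵀ * R * (P.1 * N) := by
          rw [Matrix.transpose_mul]; simp only [Matrix.mul_assoc]
      _ = P.1ᵀ * (M.1ᵀ * R * M.1) * P.1 := by
          rw [← hMP, Matrix.transpose_mul]; simp only [Matrix.mul_assoc]
      _ = _ := by rw [hM]
  have hNdet : N.det = 1 := by
    have := congrArg Matrix.det hMP
    rw [Matrix.det_mul, Matrix.det_mul, hM1, one_mul] at this
    exact mul_left_cancel₀ hP.ne' (by rw [← this, mul_one])
  have hN2 : N.col 2 = Pi.single 2 1 := by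
    have h1 : P.1 *ᵥ Pi.single 2 1 = c • v := by rw [Matrix.mulVec_single_one, hc]
    have h2 : P.1 *ᵥ (N *ᵥ Pi.single 2 1) = P.1 *ᵥ Pi.single 2 1 := by
      rw [Matrix.mulVec_mulVec, ← hMP, ← Matrix.mulVec_mulVec, h1, Matrix.mulVec_smul, hMv]
    rw [← Matrix.mulVec_single_one]
    have h3 := congrArg (fun x => ((P⁻¹ : GL (Fin 3) ℝ) : Matrix (Fin 3) (Fin 3) ℝ) *ᵥ x) h2
    simpa only [Matrix.mulVec_mulVec, hPinv, ← Matrix.mul_assoc, Matrix.one_mul,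
      Matrix.one_mulVec] using h3
  have e02 : N 0 2 = 0 := by simpa using congrFun hN2 0
  have e12 : N 1 2 = 0 := by simpa using congrFun hN2 1
  have e22 : N 2 2 = 1 := by simpa using congrFun hN2 2
  have e : ∀ i j, (Nᵀ * Matrix.diagonal ![x, y, z] * N) i j = Matrix.diagonal ![x, y, z] i j :=
    fun i j => by rw [hND]
  simp only [Matrix.mul_apply, Fin.sum_univ_three, Matrix.transpose_apply,
    Matrix.diagonal_apply] at e
  have e20 : N 2 0 = 0 := by
    have := e 2 0
    simp [e02, e12, e22, hz] at this
    exact this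
  have e21 : N 2 1 = 0 := by
    have := e 2 1
    simp [e02, e12, e22, hz] at this
    exact this
  have e00 := e 0 0
  have e01 := e 0 1
  have e11 := e 1 1
  simp [e20, e21] at e00 e01 e11
  rw [Matrix.det_fin_three] at hNdet
  simp only [e02, e12, e22, e20, e21] at hNdet
  -- The plane block has determinant 1, so its inverse is its adjugate; the entries are compared in
  -- DN = (N⁻¹)ᵀD with D = diag(x, y).
  have hs : N 1 1 = N 0 0 := by
    apply mul_left_cancel₀ hx
    linear_combination (-N 1 1) * e00 + N 1 0 * e01 + x * N 0 0 * hNdet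
  have hq : N 0 1 = -(y / x) * N 1 0 := by
    field_simp
    linear_combination N 1 1 * e01 - N 1 0 * e11 - x * N 0 1 * hNdet
  have hk0 : y / x ≠ 0 := div_ne_zero hy hx
  have hxk : y = y / x * x := by field_simp
  set k := y / x with hk
  have hpk : N 0 0 ^ 2 + k * N 1 0 ^ 2 = 1 := by
    rw [hs, hq] at hNdet
    linear_combination hNdet
  have hNeq : N = !![N 0 0, -k * N 1 0, 0; N 1 0, N 0 0, 0; 0, 0, 1] := by
    ext i j
    fin_cases i <;> fin_cases j <;> simp [e02, e12, e22, e20, e21, hs, hq]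
  set p := N 0 0 with hp
  set r := N 1 0 with hr
  have key : ∀ (Q : Matrix (Fin 3) (Fin 3) ℝ) (hQ : 0 < Q.det) (N' : Matrix (Fin 3) (Fin 3) ℝ),
      N * Q = Q * N' → ∃ P' : GL (Fin 3) ℝ, 0 < P'.1.det ∧ (P'⁻¹ * M * P').1 = N' := by
    intro Q hQ N' hN'
    refine ⟨P * Matrix.GeneralLinearGroup.mkOfDetNeZero Q hQ.ne', ?_, ?_⟩
    · rw [Units.val_mul, Matrix.det_mul]
      exact mul_pos hP hQ
    · apply conj_val_eq
      rw [Units.val_mul, ← Matrix.mul_assoc, hMP, Matrix.mul_assoc, Matrix.mul_assoc]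
      exact congrArg _ hN'
  rcases lt_or_gt_of_ne hk0 with hneg | hpos
  · obtain ⟨l, hl, hkl⟩ : ∃ l : ℝ, 0 < l ∧ k = -l ^ 2 :=
      ⟨√(-k), Real.sqrt_pos.2 (by linarith), by rw [Real.sq_sqrt (by linarith)]; ring⟩
    have ht : (p + l * r) * (p - l * r) = 1 := by
      rw [hkl] at hpk
      linear_combination hpk
    have htinv : (p + l * r)⁻¹ = p - l * r := inv_eq_of_mul_eq_one_right ht
    -- The first two columns are the null directions of the indefinite plane, eigenvectors of N for
    -- p + lr and p - lr.
    obtain ⟨P', hP', hP''⟩ := key !![l, -l, 0; 1, 1, 0; 0, 0, 1]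
      (by simp [Matrix.det_fin_three]; linarith)
      !![p + l * r, 0, 0; 0, (p + l * r)⁻¹, 0; 0, 0, 1] (by
        rw [hNeq, htinv, hkl]
        ext i j
        fin_cases i <;> fin_cases j <;> simp [Matrix.mul_apply, Fin.sum_univ_three] <;> ring)
    exact ⟨P', hP', Or.inl ⟨_, left_ne_zero_of_mul_eq_one ht, hP''⟩⟩
  · obtain ⟨l, hl, hkl⟩ : ∃ l : ℝ, 0 < l ∧ k = l ^ 2 :=
      ⟨√k, Real.sqrt_pos.2 hpos, by rw [Real.sq_sqrt hpos.le]⟩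
    -- Since y = l²x, stretching the first axis by l makes the form on the plane a multiple of the
    -- Euclidean one.
    obtain ⟨P', hP', hP''⟩ := key !![l, 0, 0; 0, 1, 0; 0, 0, 1]
      (by simpa [Matrix.det_fin_three] using hl) (rotation p (l * r)) (by
        rw [hNeq, hkl, rotation]
        ext i j
        fin_cases i <;> fin_cases j <;> simp [Matrix.mul_apply, Fin.sum_univ_three] <;> ring)
    refine ⟨P', hP', Or.inr ⟨p, l * r, ?_, hP''⟩⟩
    rw [hkl] at hpk
    linear_combination hpk

/-! ### Fixed vectors of symmetries are not null -/

theorem isotropy_apply_fin {Γ : Christoffel 3} {T : GL (Fin 3) ℝ} (hT : T ∈ isotropy Γ)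
    {N : Matrix (Fin 3) (Fin 3) ℝ} (hN : T.1 = N) (i j k : Fin 3) :
    ∑ a, ∑ b, N a i * N b j * Γ a b k = ∑ n, N k n * Γ i j n := by
  subst hN
  exact isotropy_apply hT i j k

/-- If a torsion-free structure is invariant under a full unipotent Jordan block, then the
fixed vector is orthogonal to the third basis vector with respect to the Ricci tensor. -/
theorem ricci_eq_zero_of_unipotent {Γ : Christoffel 3} (hΓ : TorsionFree Γ) {T : GL (Fin 3) ℝ}
    (hT : T ∈ isotropy Γ) (hN : T.1 = !![1, 1, 0; 0, 1, 1; 0, 0, 1]) :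
    ricci Γ 0 2 = 0 := by
  have e := isotropy_apply_fin hT hN
  have s10 : ∀ k, Γ 1 0 k = Γ 0 1 k := fun k => hΓ _ _ _
  have s20 : ∀ k, Γ 2 0 k = Γ 0 2 k := fun k => hΓ _ _ _
  have s21 : ∀ k, Γ 2 1 k = Γ 1 2 k := fun k => hΓ _ _ _
  simp only [Fin.sum_univ_three] at e
  have e00 := fun k => e 0 0 k
  have e01 := fun k => e 0 1 k
  have e11 := fun k => e 1 1 k
  have e02 := fun k => e 0 2 k
  have e12 := fun k => e 1 2 k
  have e22 := fun k => e 2 2 k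
  simp [Fin.forall_fin_succ, s10, s20, s21] at e00 e01 e11 e02 e12 e22
  obtain ⟨e000, e001⟩ := e00
  obtain ⟨e010, e011, e012⟩ := e01
  obtain ⟨e110, e111, e112⟩ := e11
  obtain ⟨e020, e021, e022⟩ := e02
  obtain ⟨e120, e121, e122⟩ := e12
  obtain ⟨e220, e221, e222⟩ := e22
  -- The invariance equations are linear in Γ and force seven symbols to vanish; every product in
  -- ρ_13 contains one of them.
  have z002 : Γ 0 0 2 = 0 := by linarith
  have z001 : Γ 0 0 1 = 0 := by linarith
  have z012 : Γ 0 1 2 = 0 := by linarith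
  have z000 : Γ 0 0 0 = 0 := by linarith
  have z011 : Γ 0 1 1 = 0 := by linarith
  have z022 : Γ 0 2 2 = 0 := by linarith
  have z021 : Γ 0 2 1 = 0 := by linarith
  simp [ricci, curvature, Fin.sum_univ_three, s10, s20, s21, z002, z001, z012, z000, z011, z022,
    z021]

/-- The fixed vectors of a non-trivial symmetry are not null for a non-degenerate Ricci tensor. -/
theorem nonnull_of_fixed {Γ : Christoffel 3} (hΓ : TorsionFree Γ) (hdet : (ricci Γ).det ≠ 0)
    {M : GL (Fin 3) ℝ} (hM : M ∈ isotropy Γ) (hM1 : M ≠ 1) {v : Fin 3 → ℝ} (hv0 : v ≠ 0)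
    (hMv : M.1 *ᵥ v = v) : v ⬝ᵥ ricci Γ *ᵥ v ≠ 0 := by
  intro hv
  have hR : (ricci Γ).IsSymm := Matrix.IsSymm.ext fun i j => ricci_symm hΓ _ _
  have hMR := ricci_isotropy hM
  have hMdet := det_isotropy hdet hM
  set R := ricci Γ with hRdef
  obtain ⟨y, hy⟩ := exists_form_ne_zero hdet hv0
  set β := y ⬝ᵥ R *ᵥ v with hβ
  have hvy : v ⬝ᵥ R *ᵥ y = β := by rw [form_symm hR]
  set w := (R *ᵥ v) ⨯₃ (R *ᵥ y) with hw
  have hwv : w ⬝ᵥ R *ᵥ v = 0 := by rw [dotProduct_comm, hw, dot_self_cross]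
  have hwy : w ⬝ᵥ R *ᵥ y = 0 := by rw [dotProduct_comm, hw, dot_cross_self]
  have hvw : v ⬝ᵥ R *ᵥ w = 0 := by rw [form_symm hR, hwv]
  have hyw : y ⬝ᵥ R *ᵥ w = 0 := by rw [form_symm hR, hwy]
  -- By the Lagrange identity and ρ(v, v) = 0, this determinant is β².
  have hPdet : (ofColumns v w y).det ≠ 0 := by
    rw [det_ofColumns, triple_product_permutation, hw, cross_dot_cross, dotProduct_comm _ y,
      dotProduct_comm _ v, dotProduct_comm _ v, hv, hvy, ← hβ]
    simpa using hy
  set P : GL (Fin 3) ℝ := Matrix.GeneralLinearGroup.mkOfDetNeZero _ hPdet with hP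
  have hP1 : P.1 = ofColumns v w y := rfl
  have hcol0 : P.1.col 0 = v := rfl
  have hcol1 : P.1.col 1 = w := rfl
  have hcol2 : P.1.col 2 = y := rfl
  set ε := w ⬝ᵥ R *ᵥ w with hε
  set γ := y ⬝ᵥ R *ᵥ y with hγ
  have hJ : P.1ᵀ * R * P.1 = !![0, 0, β; 0, ε, 0; β, 0, γ] := by
    ext i j
    rw [transpose_mul_mul_apply]
    fin_cases i <;> fin_cases j <;>
      simp [hcol0, hcol1, hcol2, hv, hvy, hwv, hvw, hwy, hyw, ← hβ, ← hε, ← hγ]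
  have hε0 : ε ≠ 0 := by
    intro h0
    have := congrArg Matrix.det hJ
    have h3 : (!![0, 0, β; 0, ε, 0; β, 0, γ] : Matrix (Fin 3) (Fin 3) ℝ).det = 0 := by
      simp [Matrix.det_fin_three, h0]
    rw [h3, Matrix.det_mul, Matrix.det_mul, Matrix.det_transpose] at this
    exact mul_ne_zero (mul_ne_zero hPdet hdet) hPdet this
  set N := (P⁻¹ * M * P).1 with hN
  have hMP : M.1 * P.1 = P.1 * N := mul_eq_of_conj
  have hPinv : ((P⁻¹ : GL (Fin 3) ℝ) : Matrix (Fin 3) (Fin 3) ℝ) * P.1 = 1 := P.inv_mul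
  have hNJ : Nᵀ * (P.1ᵀ * R * P.1) * N = P.1ᵀ * R * P.1 := by
    calc Nᵀ * (P.1ᵀ * R * P.1) * N = (P.1 * N)ᵀ * R * (P.1 * N) := by
          rw [Matrix.transpose_mul]; simp only [Matrix.mul_assoc]
      _ = P.1ᵀ * (M.1ᵀ * R * M.1) * P.1 := by
          rw [← hMP, Matrix.transpose_mul]; simp only [Matrix.mul_assoc]
      _ = _ := by rw [hMR]
  rw [hJ] at hNJ
  have hNdet : N.det = 1 := by
    have := congrArg Matrix.det hMP
    rw [Matrix.det_mul, Matrix.det_mul, hMdet, one_mul] at this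
    exact mul_left_cancel₀ hPdet (by rw [hP1] at this; rw [← this, mul_one])
  have hN0 : N.col 0 = Pi.single 0 1 := by
    have h1 : P.1 *ᵥ Pi.single 0 1 = v := by rw [Matrix.mulVec_single_one, hcol0]
    have h2 : P.1 *ᵥ (N *ᵥ Pi.single 0 1) = P.1 *ᵥ Pi.single 0 1 := by
      rw [Matrix.mulVec_mulVec, ← hMP, ← Matrix.mulVec_mulVec, h1, hMv]
    rw [← Matrix.mulVec_single_one]
    have h3 := congrArg (fun x => ((P⁻¹ : GL (Fin 3) ℝ) : Matrix (Fin 3) (Fin 3) ℝ) *ᵥ x) h2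
    simpa only [Matrix.mulVec_mulVec, hPinv, ← Matrix.mul_assoc, Matrix.one_mul,
      Matrix.one_mulVec] using h3
  have e00 : N 0 0 = 1 := by simpa using congrFun hN0 0
  have e10 : N 1 0 = 0 := by simpa using congrFun hN0 1
  have e20 : N 2 0 = 0 := by simpa using congrFun hN0 2
  have e := fun i j => congrFun (congrFun hNJ i) j
  simp only [Matrix.mul_apply, Fin.sum_univ_three, Matrix.transpose_apply] at e
  have e21 : N 2 1 = 0 := by
    have := e 0 1
    simp [e00, e10, e20, hy] at this
    exact this
  have e22 : N 2 2 = 1 := by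
    have := e 0 2
    simp [e00, e10, e20] at this
    exact mul_left_cancel₀ hy (by linear_combination this)
  have e11 : N 1 1 = 1 := by
    rw [Matrix.det_fin_three] at hNdet
    simp only [e00, e10, e20, e21, e22] at hNdet
    linear_combination hNdet
  have e12 := e 1 2
  have e22' := e 2 2
  simp [e21, e22, e11] at e12 e22'
  have hx : N 0 1 * β = -ε * N 1 2 := by linear_combination e12
  -- N is upper unitriangular by now; with this entry zero, invariance of the form would leave only
  -- N = 1.
  have hq : N 1 2 ≠ 0 := by
    intro hq
    have hx0 : N 0 1 = 0 := by
      rw [hq, mul_zero] at hx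
      exact (mul_eq_zero.1 hx).resolve_right hy
    have hy0 : N 0 2 = 0 := by
      have : 2 * β * N 0 2 = 0 := by rw [hq] at e22'; linear_combination e22'
      exact (mul_eq_zero.1 this).resolve_left (by simpa using hy)
    apply hM1
    have hN1 : N = 1 := by
      ext i j
      fin_cases i <;> fin_cases j <;> simp [e00, e10, e20, e21, e22, e11, hq, hx0, hy0]
    have h1 : P⁻¹ * M * P = 1 := Units.ext hN1
    calc M = P * (P⁻¹ * M * P) * P⁻¹ := by group
      _ = 1 := by rw [h1]; group
  have hx0 : N 0 1 ≠ 0 := by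
    intro h0
    rw [h0, zero_mul] at hx
    exact mul_ne_zero (neg_ne_zero.2 hε0) hq hx.symm
  have hNeq : N = !![1, N 0 1, N 0 2; 0, 1, N 1 2; 0, 0, 1] := by
    ext i j
    fin_cases i <;> fin_cases j <;> simp [e00, e10, e20, e21, e22, e11]
  set x := N 0 1
  set z := N 0 2
  set q := N 1 2
  -- The columns form the Jordan chain (N - 1)²e₃, (N - 1)e₃, e₃.
  have hQdet : (!![x * q, z, 0; 0, q, 0; 0, 0, 1] : Matrix (Fin 3) (Fin 3) ℝ).det ≠ 0 := by
    simp [Matrix.det_fin_three, hx0, hq]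
  set Q : GL (Fin 3) ℝ := Matrix.GeneralLinearGroup.mkOfDetNeZero _ hQdet with hQ
  have hQ1 : Q.1 = !![x * q, z, 0; 0, q, 0; 0, 0, 1] := rfl
  have hmem := (conj_mem_isotropy_pullback (P * Q)).2 hM
  have hval : ((P * Q)⁻¹ * M * (P * Q)).1 = !![1, 1, 0; 0, 1, 1; 0, 0, 1] := by
    apply conj_val_eq
    rw [Units.val_mul, ← Matrix.mul_assoc, hMP, Matrix.mul_assoc, Matrix.mul_assoc]
    congr 1
    rw [hNeq, hQ1]
    ext i j
    fin_cases i <;> fin_cases j <;> simp [Matrix.mul_apply, Fin.sum_univ_three, add_comm]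
  -- In the Jordan basis this entry of the Ricci tensor is xqβ, which is not zero.
  have hzero := ricci_eq_zero_of_unipotent (hΓ.pullback (P * Q)) hmem hval
  rw [pullback_mul, ricci_pullback, ricci_pullback, ← hRdef, hJ, hQ1] at hzero
  simp [Matrix.mul_apply, Fin.sum_univ_three, hx0, hq, hy] at hzero

/-- The normal form of a non-trivial symmetry. -/
theorem exists_conj_normal_form {Γ : Christoffel 3} (hΓ : TorsionFree Γ)
    (hdet : (ricci Γ).det ≠ 0) {M : GL (Fin 3) ℝ} (hM : M ∈ isotropy Γ) (hM1 : M ≠ 1) :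
    ∃ P : GL (Fin 3) ℝ, 0 < P.1.det ∧
      ((∃ t : ℝ, t ≠ 0 ∧ (P⁻¹ * M * P).1 = !![t, 0, 0; 0, t⁻¹, 0; 0, 0, 1]) ∨
        ∃ p q : ℝ, p ^ 2 + q ^ 2 = 1 ∧ (P⁻¹ * M * P).1 = rotation p q) := by
  obtain ⟨v, hv0, hMv⟩ := exists_fixed_vector hdet (ricci_isotropy hM) (det_isotropy hdet hM)
  exact exists_conj_of_nonnull_fixed (Matrix.IsSymm.ext fun i j => ricci_symm hΓ _ _) hdet
    (ricci_isotropy hM) (det_isotropy hdet hM) (nonnull_of_fixed hΓ hdet hM hM1 hv0 hMv) hMv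

theorem pullback_eq_of_val {T : GL (Fin 3) ℝ} {N : Matrix (Fin 3) (Fin 3) ℝ} (hN : T.1 = N)
    {Γ Γ' : Christoffel 3}
    (h : ∀ i j k, ∑ a, ∑ b, N a i * N b j * Γ a b k = ∑ n, N k n * Γ' i j n) :
    pullback T Γ = Γ' := by
  subst hN
  rw [pullback_eq_iff]
  intro i j
  funext k
  exact h i j k

/-! ### Ricci tensors of the normal forms -/

theorem ricci_hyperbolicModel (a b c d : ℝ) :
    ricci (hyperbolicModel a b c d) =
      !![0, a * d, 0; a * d, 0, 0; 0, 0, -b ^ 2 + b * d + c * (-c + d)] := by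
  ext i j
  fin_cases i <;> fin_cases j <;>
    simp [ricci, curvature, hyperbolicModel, ofMatrices, Fin.sum_univ_three] <;> ring

theorem ricci_rotationModel (a b c d : ℝ) :
    ricci (rotationModel a b c d) =
      !![a * d, 0, 0; 0, a * d, 0; 0, 0, 2 * (b * d - b ^ 2 + c ^ 2)] := by
  ext i j
  fin_cases i <;> fin_cases j <;>
    simp [ricci, curvature, rotationModel, ofMatrices, Fin.sum_univ_three] <;> ring

theorem ricci_orderThreeModel (a b c d : ℝ) :
    ricci (orderThreeModel a b c d) =
      !![a * d - 2, 0, 0; 0, a * d - 2, 0; 0, 0, 2 * (b * d - b ^ 2 + c ^ 2)] := by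
  ext i j
  fin_cases i <;> fin_cases j <;>
    simp [ricci, curvature, orderThreeModel, ofMatrices, Fin.sum_univ_three] <;> ring

theorem ricci_kleinModel : ricci kleinModel = !![-2, 0, 0; 0, 2, 0; 0, 0, 2] := by
  ext i j
  fin_cases i <;> fin_cases j <;>
    simp [ricci, curvature, kleinModel, ofMatrices, Fin.sum_univ_three] <;> norm_num

theorem ricci_orderTwoModel (a b c d e f g h : ℝ) :
    ricci (orderTwoModel a b c d e f g h) =
      !![-2 * b * d + a * (-c + g + h), -d * e - a * f + b * h, 0;
         -d * e - a * f + b * h, -2 * b * f + e * (c - g + h), 0;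
         0, 0, -c ^ 2 - 2 * d * f + c * h + g * (-g + h)] := by
  ext i j
  fin_cases i <;> fin_cases j <;>
    simp [ricci, curvature, orderTwoModel, ofMatrices, Fin.sum_univ_three] <;> ring

/-! ### Structures invariant under a given symmetry -/

/-- A diagonal symmetry scales Γ_ij^k by τ_i τ_j / τ_k, so only symbols with trivial factor survive.
-/
theorem apply_eq_zero_of_diagonal {m : ℕ} {Γ : Christoffel m} {T : GL (Fin m) ℝ}
    (hT : T ∈ isotropy Γ) {τ : Fin m → ℝ} (hτ : T.1 = Matrix.diagonal τ) {i j k : Fin m}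
    (h : τ i * τ j - τ k ≠ 0) : Γ i j k = 0 := by
  have e := isotropy_apply hT i j k
  simp only [hτ, Matrix.diagonal_apply, ite_mul, mul_ite, zero_mul, mul_zero, Finset.sum_ite_eq,
    Finset.sum_ite_eq', Finset.mem_univ, if_true] at e
  apply (mul_eq_zero.1 _).resolve_left h
  linear_combination e

/-- Invariance under a hyperbolic rotation that is not an involution. -/
theorem eq_hyperbolicModel {Γ : Christoffel 3} (hΓ : TorsionFree Γ) {T : GL (Fin 3) ℝ}
    (hT : T ∈ isotropy Γ) {t : ℝ} (ht : t ≠ 0) (ht2 : t ^ 2 ≠ 1)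
    (hN : T.1 = !![t, 0, 0; 0, t⁻¹, 0; 0, 0, 1]) :
    ∃ a b c d, Γ = hyperbolicModel a b c d := by
  have hτ : T.1 = Matrix.diagonal ![t, t⁻¹, 1] := by
    rw [hN]
    ext i j
    fin_cases i <;> fin_cases j <;> simp
  -- The factors that occur are the powers of t with exponents from -3 to 3. For real t with t² ≠ 1,
  -- only the exponent 0 gives 1.
  have ht1 : t ≠ 1 := by rintro rfl; norm_num at ht2
  have ht3 : t ^ 3 ≠ 1 := by
    intro h
    have : (t - 1) * ((t + 1 / 2) ^ 2 + 3 / 4) = 0 := by linear_combination h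
    rcases mul_eq_zero.1 this with h1 | h1
    · exact ht1 (by linarith)
    · nlinarith [sq_nonneg (t + 1 / 2)]
  have key : ∀ i j k : Fin 3, ![t, t⁻¹, 1] i * ![t, t⁻¹, 1] j - ![t, t⁻¹, 1] k ≠ 0 → Γ i j k = 0 :=
    fun i j k h => apply_eq_zero_of_diagonal hT hτ h
  have h1 : t - 1 ≠ 0 := sub_ne_zero.2 ht1
  have h2 : t ^ 2 - 1 ≠ 0 := sub_ne_zero.2 ht2
  have h3 : t ^ 3 - 1 ≠ 0 := sub_ne_zero.2 ht3
  have z000 : Γ 0 0 0 = 0 := key _ _ _ (by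
    simpa [← mul_sub_one, ht] using h1)
  have z001 : Γ 0 0 1 = 0 := key _ _ _ (by
    have : t * t - t⁻¹ = t⁻¹ * (t ^ 3 - 1) := by field_simp
    simp [this, h3, ht])
  have z002 : Γ 0 0 2 = 0 := key _ _ _ (by simpa [← sq] using h2)
  have z010 : Γ 0 1 0 = 0 := key _ _ _ (by
    simpa [ht] using sub_ne_zero.2 (Ne.symm ht1))
  have z011 : Γ 0 1 1 = 0 := key _ _ _ (by
    have : 1 - t⁻¹ = t⁻¹ * (t - 1) := by field_simp
    simp [this, h1, ht])
  have z110 : Γ 1 1 0 = 0 := key _ _ _ (by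
    have : t⁻¹ * t⁻¹ - t = -(t⁻¹ * t⁻¹ * (t ^ 3 - 1)) := by field_simp; ring
    simp [this, h3, ht])
  have z111 : Γ 1 1 1 = 0 := key _ _ _ (by
    have : t⁻¹ * t⁻¹ - t⁻¹ = -(t⁻¹ * t⁻¹ * (t - 1)) := by field_simp; ring
    simp [this, h1, ht])
  have z112 : Γ 1 1 2 = 0 := key _ _ _ (by
    have : t⁻¹ * t⁻¹ - 1 = -(t⁻¹ * t⁻¹ * (t ^ 2 - 1)) := by field_simp; ring
    simp [this, h2, ht])
  have z021 : Γ 0 2 1 = 0 := key _ _ _ (by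
    have : t - t⁻¹ = t⁻¹ * (t ^ 2 - 1) := by field_simp
    simp [this, h2, ht])
  have z022 : Γ 0 2 2 = 0 := key _ _ _ (by simpa using h1)
  have z120 : Γ 1 2 0 = 0 := key _ _ _ (by
    have : t⁻¹ - t = -(t⁻¹ * (t ^ 2 - 1)) := by field_simp; ring
    simp [this, h2, ht])
  have z122 : Γ 1 2 2 = 0 := key _ _ _ (by
    have : t⁻¹ - 1 = -(t⁻¹ * (t - 1)) := by field_simp; ring
    simp [this, h1, ht])
  have z220 : Γ 2 2 0 = 0 := key _ _ _ (by simpa using sub_ne_zero.2 (Ne.symm ht1))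
  have z221 : Γ 2 2 1 = 0 := key _ _ _ (by
    have : 1 - t⁻¹ = t⁻¹ * (t - 1) := by field_simp
    simp [this, h1, ht])
  refine ⟨Γ 0 1 2, Γ 0 2 0, Γ 1 2 1, Γ 2 2 2, ?_⟩
  funext i j k
  fin_cases i <;> fin_cases j <;> fin_cases k <;>
    simp [hyperbolicModel, ofMatrices, hΓ 1 0, hΓ 2 0, hΓ 2 1, *]

/-- Multiplication by a complex number a + ib ≠ 1 fixes only 0; the determinant involved is |a + ib
- 1|². -/
theorem eq_zero_of_rotation_fixed {a b X Y : ℝ} (h : a ≠ 1 ∨ b ≠ 0) (h1 : a * X - b * Y = X)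
    (h2 : b * X + a * Y = Y) : X = 0 ∧ Y = 0 := by
  have hpos : (a - 1) ^ 2 + b ^ 2 ≠ 0 := by
    rcases h with h | h
    · have := sub_ne_zero.2 h
      positivity
    · positivity
  constructor
  · apply (mul_eq_zero.1 _).resolve_left hpos
    linear_combination (a - 1) * h1 + b * h2
  · apply (mul_eq_zero.1 _).resolve_left hpos
    linear_combination (a - 1) * h2 - b * h1

/-- The general structure that is invariant under a rotation of order three about the third
axis. -/
def triangularModel (a b c d α β : ℝ) : Christoffel 3 :=
  ofMatrices
    !![α, β, b; β, -α, -c; b, -c, 0]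
    !![β, -α, c; -α, -β, b; c, b, 0]
    !![a, 0, 0; 0, a, 0; 0, 0, d]

/-- Invariance under a rotation that is not an involution. -/
theorem eq_triangularModel {Γ : Christoffel 3} (hΓ : TorsionFree Γ) {T : GL (Fin 3) ℝ}
    (hT : T ∈ isotropy Γ) {p q : ℝ} (hpq : p ^ 2 + q ^ 2 = 1) (hq : q ≠ 0)
    (hN : T.1 = rotation p q) : ∃ a b c d α β, Γ = triangularModel a b c d α β := by
  have e := isotropy_apply_fin hT hN
  have s10 : ∀ k, Γ 1 0 k = Γ 0 1 k := fun k => hΓ _ _ _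
  have s20 : ∀ k, Γ 2 0 k = Γ 0 2 k := fun k => hΓ _ _ _
  have s21 : ∀ k, Γ 2 1 k = Γ 1 2 k := fun k => hΓ _ _ _
  simp only [Fin.sum_univ_three] at e
  have e000 := e 0 0 0
  have e001 := e 0 0 1
  have e002 := e 0 0 2
  have e010 := e 0 1 0
  have e011 := e 0 1 1
  have e012 := e 0 1 2
  have e110 := e 1 1 0
  have e111 := e 1 1 1
  have e112 := e 1 1 2
  have e020 := e 0 2 0
  have e021 := e 0 2 1
  have e022 := e 0 2 2
  have e120 := e 1 2 0
  have e121 := e 1 2 1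
  have e122 := e 1 2 2
  have e220 := e 2 2 0
  have e221 := e 2 2 1
  clear e
  simp [rotation, s10, s20, s21, -mul_eq_mul_left_iff, -mul_eq_mul_right_iff] at e000 e001 e002
  simp [rotation, s10, s20, s21, -mul_eq_mul_left_iff, -mul_eq_mul_right_iff] at e010 e011 e012
  simp [rotation, s10, s20, s21, -mul_eq_mul_left_iff, -mul_eq_mul_right_iff] at e110 e111 e112
  simp [rotation, s10, s20, s21, -mul_eq_mul_left_iff, -mul_eq_mul_right_iff] at e020 e021 e022
  simp [rotation, s10, s20, s21, -mul_eq_mul_left_iff, -mul_eq_mul_right_iff] at e120 e121 e122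
  simp [rotation, s10, s20, s21, -mul_eq_mul_left_iff, -mul_eq_mul_right_iff] at e220 e221
  -- With λ = p + iq, the symbols split into weights 0, ±1, ±2, ±3. As q ≠ 0, neither λ nor λ² is 1,
  -- so the components of weights one and two, written as pairs X, Y below, vanish. The weight three
  -- part α, β may survive.
  have hlam2 : p ^ 2 - q ^ 2 ≠ 1 ∨ 2 * p * q ≠ 0 := by
    left
    intro h
    apply hq
    have : q ^ 2 = 0 := by linarith
    simpa using this
  obtain ⟨a1, a2⟩ := eq_zero_of_rotation_fixed (a := p) (b := q) (X := Γ 2 2 0) (Y := Γ 2 2 1)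
    (Or.inr hq) (by linear_combination -e220) (by linear_combination -e221)
  obtain ⟨b1, b2⟩ := eq_zero_of_rotation_fixed (a := p) (b := -q) (X := Γ 0 2 2) (Y := Γ 1 2 2)
    (Or.inr (neg_ne_zero.2 hq)) (by linear_combination e022) (by linear_combination e122)
  obtain ⟨c1, c2⟩ := eq_zero_of_rotation_fixed (X := Γ 0 2 0 - Γ 1 2 1)
    (Y := Γ 0 2 1 + Γ 1 2 0) hlam2
    (by linear_combination (-p) * (e020 - e121) + q * (e021 + e120) +
          (Γ 0 2 0 - Γ 1 2 1) * hpq)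
    (by linear_combination (-p) * (e021 + e120) - q * (e020 - e121) +
          (Γ 0 2 1 + Γ 1 2 0) * hpq)
  obtain ⟨d1, d2⟩ := eq_zero_of_rotation_fixed (X := Γ 0 0 2 - Γ 1 1 2)
    (Y := -2 * Γ 0 1 2) hlam2
    (by linear_combination e002 - e112)
    (by linear_combination -2 * e012)
  obtain ⟨f1, f2⟩ := eq_zero_of_rotation_fixed (a := p) (b := q)
    (X := Γ 0 0 0 - Γ 1 1 0 + 2 * Γ 0 1 1) (Y := Γ 0 0 1 - Γ 1 1 1 - 2 * Γ 0 1 0) (Or.inr hq)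
    (by linear_combination p * (e000 - e110 + 2 * e011) + q * (e001 - e111 - 2 * e010) -
          (p * (Γ 0 0 0 - Γ 1 1 0 + 2 * Γ 0 1 1) - q * (Γ 0 0 1 - Γ 1 1 1 - 2 * Γ 0 1 0) -
            (Γ 0 0 0 - Γ 1 1 0 + 2 * Γ 0 1 1)) * hpq)
    (by linear_combination p * (e001 - e111 - 2 * e010) - q * (e000 - e110 + 2 * e011) -
          (q * (Γ 0 0 0 - Γ 1 1 0 + 2 * Γ 0 1 1) + p * (Γ 0 0 1 - Γ 1 1 1 - 2 * Γ 0 1 0) -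
            (Γ 0 0 1 - Γ 1 1 1 - 2 * Γ 0 1 0)) * hpq)
  obtain ⟨g1, g2⟩ := eq_zero_of_rotation_fixed (a := p) (b := q)
    (X := Γ 0 0 0 + Γ 1 1 0) (Y := Γ 0 0 1 + Γ 1 1 1) (Or.inr hq)
    (by linear_combination -(e000 + e110) + (Γ 0 0 0 + Γ 1 1 0) * hpq)
    (by linear_combination -(e001 + e111) + (Γ 0 0 1 + Γ 1 1 1) * hpq)
  refine ⟨Γ 0 0 2, Γ 0 2 0, Γ 0 2 1, Γ 2 2 2, Γ 0 0 0, Γ 0 0 1, ?_⟩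
  funext i j k
  fin_cases i <;> fin_cases j <;> fin_cases k <;>
    simp [triangularModel, ofMatrices, s10, s20, s21, a1, a2, b1, b2] <;> linarith

/-- Normalisation of the part of weight three by a similarity of the plane. -/
theorem exists_pullback_triangularModel (a b c d : ℝ) {α β : ℝ} (h : ¬(α = 0 ∧ β = 0)) :
    ∃ P : GL (Fin 3) ℝ, 0 < P.1.det ∧ ∃ a',
      pullback P (triangularModel a b c d α β) = orderThreeModel a' b c d := by
  -- On the plane viewed as ℂ, the part of weight three is the product κ z̄ w̄ with κ = α + iβ. The
  -- similarity z ↦ sz normalises it to z̄ w̄ when s = κ s̄², which is solved by s = u/|u|⁴ with u³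
  -- = κ. Below, s = l + ik.
  obtain ⟨u, hu⟩ := IsAlgClosed.exists_pow_nat_eq (⟨α, β⟩ : ℂ) (n := 3) (by norm_num)
  set x := u.re with hx
  set y := u.im with hy
  have hα : α = x ^ 3 - 3 * x * y ^ 2 := by
    have := congrArg Complex.re hu
    simp [pow_succ] at this
    linear_combination -this
  have hβ : β = 3 * x ^ 2 * y - y ^ 3 := by
    have := congrArg Complex.im hu
    simp [pow_succ] at this
    linear_combination -this
  have hn : 0 < x ^ 2 + y ^ 2 := by
    by_contra hn
    have hx0 : x = 0 := by nlinarith [sq_nonneg x, sq_nonneg y]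
    have hy0 : y = 0 := by nlinarith [sq_nonneg x, sq_nonneg y]
    exact h ⟨by rw [hα, hx0, hy0]; ring, by rw [hβ, hx0, hy0]; ring⟩
  obtain ⟨l, k, hl, hk, hlk⟩ : ∃ l k : ℝ, l = α * (l ^ 2 - k ^ 2) + 2 * β * l * k ∧
      k = β * (l ^ 2 - k ^ 2) - 2 * α * l * k ∧ 0 < l ^ 2 + k ^ 2 := by
    refine ⟨x / (x ^ 2 + y ^ 2) ^ 2, y / (x ^ 2 + y ^ 2) ^ 2, ?_, ?_, ?_⟩
    · rw [hα, hβ]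
      field_simp
      ring
    · rw [hα, hβ]
      field_simp
      ring
    · have : (x / (x ^ 2 + y ^ 2) ^ 2) ^ 2 + (y / (x ^ 2 + y ^ 2) ^ 2) ^ 2 =
          (x ^ 2 + y ^ 2) / (x ^ 2 + y ^ 2) ^ 4 := by
        field_simp
      rw [this]
      positivity
  have hdet : (!![l, -k, 0; k, l, 0; 0, 0, 1] : Matrix (Fin 3) (Fin 3) ℝ).det =
      l ^ 2 + k ^ 2 := by
    simp [Matrix.det_fin_three]
    ring
  refine ⟨Matrix.GeneralLinearGroup.mkOfDetNeZero _ (ne_of_eq_of_ne hdet hlk.ne'),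
    by rw [← hdet] at hlk; exact hlk, a * (l ^ 2 + k ^ 2), pullback_eq_of_val rfl ?_⟩
  intro i j m
  fin_cases i <;> fin_cases j <;> fin_cases m <;>
    simp [Fin.sum_univ_three, triangularModel, orderThreeModel, ofMatrices,
      -mul_eq_mul_left_iff, -mul_eq_mul_right_iff] <;> first | ring1 | linarith

/-- Invariance under the half turn about the third axis. -/
theorem eq_orderTwoModel {Γ : Christoffel 3} (hΓ : TorsionFree Γ) {T : GL (Fin 3) ℝ}
    (hT : T ∈ isotropy Γ) (hN : T.1 = Matrix.diagonal ![-1, -1, 1]) :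
    ∃ a b c d e f g h, Γ = orderTwoModel a b c d e f g h := by
  have key : ∀ i j k : Fin 3, ![(-1 : ℝ), -1, 1] i * ![(-1 : ℝ), -1, 1] j - ![(-1 : ℝ), -1, 1] k ≠ 0 →
      Γ i j k = 0 :=
    fun i j k h => apply_eq_zero_of_diagonal hT hN h
  refine ⟨Γ 0 0 2, Γ 0 1 2, Γ 0 2 0, Γ 0 2 1, Γ 1 1 2, Γ 1 2 0, Γ 1 2 1, Γ 2 2 2, ?_⟩
  funext i j k
  fin_cases i <;> fin_cases j <;> fin_cases k <;>
    simp [orderTwoModel, ofMatrices, hΓ 1 0, hΓ 2 0, hΓ 2 1] <;>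
    exact key _ _ _ (by simp <;> norm_num)

/-! ### Structures with two commuting half turns -/

/-- The structures `Γ_{12}^3 = p`, `Γ_{13}^2 = q`, `Γ_{23}^1 = r`. -/
def crossModel (p q r : ℝ) : Christoffel 3 :=
  ofMatrices
    !![0, 0, 0; 0, 0, r; 0, r, 0]
    !![0, 0, q; 0, 0, 0; q, 0, 0]
    !![0, p, 0; p, 0, 0; 0, 0, 0]

theorem kleinModel_eq : kleinModel = crossModel 1 1 (-1) := rfl

/-- Invariance under the half turns about the coordinate axes. -/
theorem eq_crossModel {Γ : Christoffel 3} (hΓ : TorsionFree Γ) {T S : GL (Fin 3) ℝ}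
    (hT : T ∈ isotropy Γ) (hN : T.1 = Matrix.diagonal ![-1, -1, 1])
    (hS : S ∈ isotropy Γ) (hS' : S.1 = Matrix.diagonal ![1, -1, -1]) :
    ∃ p q r, Γ = crossModel p q r := by
  have key : ∀ i j k : Fin 3, ![(-1 : ℝ), -1, 1] i * ![(-1 : ℝ), -1, 1] j - ![(-1 : ℝ), -1, 1] k ≠ 0 →
      Γ i j k = 0 :=
    fun i j k h => apply_eq_zero_of_diagonal hT hN h
  have key' : ∀ i j k : Fin 3, ![(1 : ℝ), -1, -1] i * ![(1 : ℝ), -1, -1] j - ![(1 : ℝ), -1, -1] k ≠ 0 →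
      Γ i j k = 0 :=
    fun i j k h => apply_eq_zero_of_diagonal hS hS' h
  refine ⟨Γ 0 1 2, Γ 0 2 1, Γ 1 2 0, ?_⟩
  funext i j k
  fin_cases i <;> fin_cases j <;> fin_cases k <;>
    simp [crossModel, ofMatrices, hΓ 1 0, hΓ 2 0, hΓ 2 1] <;>
    first
      | (apply key; simp; done)
      | (apply key; simp; norm_num; done)
      | (apply key'; simp; done)
      | (apply key'; simp; norm_num; done)

theorem ricci_crossModel (p q r : ℝ) :
    ricci (crossModel p q r) = Matrix.diagonal ![-2 * p * q, -2 * p * r, -2 * q * r] := by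
  ext i j
  fin_cases i <;> fin_cases j <;>
    simp [ricci, curvature, crossModel, ofMatrices, Fin.sum_univ_three] <;> ring

theorem exists_pullback_of_val {N : Matrix (Fin 3) (Fin 3) ℝ} (hN : 0 < N.det)
    {Γ Γ' : Christoffel 3}
    (h : ∀ i j k, ∑ a, ∑ b, N a i * N b j * Γ a b k = ∑ n, N k n * Γ' i j n) :
    ∃ P : GL (Fin 3) ℝ, 0 < P.1.det ∧ P.1 = N ∧ pullback P Γ = Γ' :=
  ⟨Matrix.GeneralLinearGroup.mkOfDetNeZero N hN.ne', hN, rfl, pullback_eq_of_val rfl h⟩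

theorem exists_sign_mul_sq {p : ℝ} (hp : p ≠ 0) :
    ∃ σ x : ℝ, (σ = 1 ∨ σ = -1) ∧ 0 < x ∧ p = σ * x ^ 2 := by
  rcases lt_or_gt_of_ne hp with h | h
  · exact ⟨-1, √(-p), Or.inr rfl, Real.sqrt_pos.2 (by linarith),
      by rw [Real.sq_sqrt (by linarith)]; ring⟩
  · exact ⟨1, √p, Or.inl rfl, Real.sqrt_pos.2 h, by rw [Real.sq_sqrt h.le]; ring⟩

theorem exists_pullback_crossModel_sign {p q r : ℝ} (hp : p ≠ 0) (hq : q ≠ 0) (hr : r ≠ 0) :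
    ∃ P : GL (Fin 3) ℝ, 0 < P.1.det ∧ ∃ σ τ υ : ℝ, (σ = 1 ∨ σ = -1) ∧ (τ = 1 ∨ τ = -1) ∧
      (υ = 1 ∨ υ = -1) ∧ pullback P (crossModel p q r) = crossModel σ τ υ := by
  obtain ⟨σ, x, hσ, hx, rfl⟩ := exists_sign_mul_sq hp
  obtain ⟨τ, y, hτ, hy, rfl⟩ := exists_sign_mul_sq hq
  obtain ⟨υ, z, hυ, hz, rfl⟩ := exists_sign_mul_sq hr
  obtain ⟨P, hP, -, h⟩ := exists_pullback_of_val
    -- Scaling the axes by s₁, s₂, s₃ multiplies the first coefficient by s₁s₂/s₃, which is 1/x²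
    -- here; the other two behave likewise.
    (N := !![1 / (x * y), 0, 0; 0, 1 / (x * z), 0; 0, 0, 1 / (y * z)])
    (Γ := crossModel (σ * x ^ 2) (τ * y ^ 2) (υ * z ^ 2)) (Γ' := crossModel σ τ υ)
    (by simp [Matrix.det_fin_three]; positivity) (by
      intro i j k
      fin_cases i <;> fin_cases j <;> fin_cases k <;>
        simp [Fin.sum_univ_three, crossModel, ofMatrices, -mul_eq_mul_left_iff,
          -mul_eq_mul_right_iff] <;> field_simp)
  exact ⟨P, hP, σ, τ, υ, hσ, hτ, hυ, h⟩

theorem exists_pullback_crossModel_cycle (p q r : ℝ) :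
    ∃ P : GL (Fin 3) ℝ, 0 < P.1.det ∧ P.1 = !![0, 0, 1; 1, 0, 0; 0, 1, 0] ∧
      pullback P (crossModel p q r) = crossModel r p q := by
  refine exists_pullback_of_val (by simp [Matrix.det_fin_three]) ?_
  intro i j k
  fin_cases i <;> fin_cases j <;> fin_cases k <;>
    simp [Fin.sum_univ_three, crossModel, ofMatrices]

/-- The exchange of two axes needs a reflection of the remaining one to preserve the orientation,
and this reflection changes all three signs. -/
theorem exists_pullback_crossModel_swap (p q r : ℝ) :
    ∃ P : GL (Fin 3) ℝ, 0 < P.1.det ∧ P.1 = !![-1, 0, 0; 0, 0, 1; 0, 1, 0] ∧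
      pullback P (crossModel p q r) = crossModel (-q) (-p) (-r) := by
  refine exists_pullback_of_val (by simp [Matrix.det_fin_three]) ?_
  intro i j k
  fin_cases i <;> fin_cases j <;> fin_cases k <;>
    simp [Fin.sum_univ_three, crossModel, ofMatrices]

theorem pullback_val_det_pos {P Q : GL (Fin 3) ℝ} (hP : 0 < P.1.det) (hQ : 0 < Q.1.det) :
    0 < (P * Q).1.det := by
  rw [Units.val_mul, Matrix.det_mul]
  exact mul_pos hP hQ

/-- The structures `crossModel` with unit coefficients of different signs are equivalent. -/
theorem exists_pullback_crossModel_klein {σ τ υ : ℝ} (hσ : σ = 1 ∨ σ = -1)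
    (hτ : τ = 1 ∨ τ = -1) (hυ : υ = 1 ∨ υ = -1) (h : ¬(σ = τ ∧ τ = υ)) :
    ∃ P : GL (Fin 3) ℝ, 0 < P.1.det ∧ pullback P (crossModel σ τ υ) = kleinModel := by
  have cyc : ∀ {p q r : ℝ},
      (∃ P : GL (Fin 3) ℝ, 0 < P.1.det ∧ pullback P (crossModel r p q) = kleinModel) →
      ∃ P : GL (Fin 3) ℝ, 0 < P.1.det ∧ pullback P (crossModel p q r) = kleinModel := by
    rintro p q r ⟨P, hP, hP'⟩
    obtain ⟨Q, hQ, -, hQ'⟩ := exists_pullback_crossModel_cycle p q r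
    exact ⟨Q * P, pullback_val_det_pos hQ hP, by rw [pullback_mul, hQ', hP']⟩
  have swap : ∀ {p q r : ℝ},
      (∃ P : GL (Fin 3) ℝ, 0 < P.1.det ∧ pullback P (crossModel (-q) (-p) (-r)) = kleinModel) →
      ∃ P : GL (Fin 3) ℝ, 0 < P.1.det ∧ pullback P (crossModel p q r) = kleinModel := by
    rintro p q r ⟨P, hP, hP'⟩
    obtain ⟨Q, hQ, -, hQ'⟩ := exists_pullback_crossModel_swap p q r
    exact ⟨Q * P, pullback_val_det_pos hQ hP, by rw [pullback_mul, hQ', hP']⟩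
  have base : ∃ P : GL (Fin 3) ℝ, 0 < P.1.det ∧
      pullback P (crossModel 1 1 (-1)) = kleinModel :=
    ⟨1, by simp, by rw [pullback_one, kleinModel_eq]⟩
  have neg : ∃ P : GL (Fin 3) ℝ, 0 < P.1.det ∧
      pullback P (crossModel (-1) (-1) 1) = kleinModel := swap (by simpa using base)
  -- The six non-constant sign patterns form two cyclic orbits, which the swap interchanges.
  rcases hσ with rfl | rfl <;> rcases hτ with rfl | rfl <;> rcases hυ with rfl | rfl
  · simp at h
  · exact base
  · exact cyc base
  · exact cyc (cyc neg)
  · exact cyc (cyc base)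
  · exact cyc neg
  · exact neg
  · simp at h

/-- An involution of determinant one that commutes with the half turn about the third axis. -/
theorem exists_simultaneous_diagonalization {S : Matrix (Fin 3) (Fin 3) ℝ}
    (hS2 : S * S = 1) (hdet : S.det = 1)
    (hcomm : S * Matrix.diagonal ![-1, -1, 1] = Matrix.diagonal ![-1, -1, 1] * S)
    (h1 : S ≠ 1) (hT : S ≠ Matrix.diagonal ![-1, -1, 1]) :
    ∃ Q : Matrix (Fin 3) (Fin 3) ℝ, 0 < Q.det ∧ S * Q = Q * Matrix.diagonal ![1, -1, -1] ∧
      Matrix.diagonal ![-1, -1, 1] * Q = Q * Matrix.diagonal ![-1, -1, 1] := by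
  have e := fun i j => congrFun (congrFun hcomm i) j
  simp only [Matrix.mul_apply, Fin.sum_univ_three, Matrix.diagonal_apply] at e
  have s02 : S 0 2 = 0 := by have := e 0 2; simp at this; linarith
  have s12 : S 1 2 = 0 := by have := e 1 2; simp at this; linarith
  have s20 : S 2 0 = 0 := by have := e 2 0; simp at this; linarith
  have s21 : S 2 1 = 0 := by have := e 2 1; simp at this; linarith
  have g := fun i j => congrFun (congrFun hS2 i) j
  simp only [Matrix.mul_apply, Fin.sum_univ_three, Matrix.one_apply] at g
  have g00 := g 0 0
  have g01 := g 0 1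
  have g10 := g 1 0
  have g11 := g 1 1
  have g22 := g 2 2
  simp [s02, s12, s20, s21] at g00 g01 g10 g11 g22
  rw [Matrix.det_fin_three] at hdet
  simp only [s02, s12, s20, s21] at hdet
  have hSeq : S = !![S 0 0, S 0 1, 0; S 1 0, S 1 1, 0; 0, 0, S 2 2] := by
    ext i j
    fin_cases i <;> fin_cases j <;> simp [s02, s12, s20, s21]
  generalize S 0 0 = a at *
  generalize S 0 1 = b at *
  generalize S 1 0 = c at *
  generalize S 1 1 = d at *
  -- An involutive plane block with non-zero trace is ±1, and then S would be 1 or the half turn. So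
  -- the block is a reflection.
  have htr : a + d = 0 := by
    by_contra hne
    have hb : b = 0 := (mul_eq_zero.1 (by linear_combination g01 : (a + d) * b = 0)).resolve_left hne
    have hc : c = 0 := (mul_eq_zero.1 (by linear_combination g10 : (a + d) * c = 0)).resolve_left hne
    subst hb hc
    have had : d = a := by
      have : (a - d) * (a + d) = 0 := by linear_combination g00 - g11
      rcases mul_eq_zero.1 this with h | h
      · linarith
      · exact absurd h hne
    have h22 : S 2 2 = 1 := by
      rw [had] at hdet
      linear_combination hdet - S 2 2 * g00
    rcases mul_self_eq_one_iff.1 (by linarith : a * a = 1) with ha | ha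
    · apply h1
      rw [hSeq, had, ha, h22]
      ext i j
      fin_cases i <;> fin_cases j <;> simp
    · apply hT
      rw [hSeq, had, ha, h22]
      ext i j
      fin_cases i <;> fin_cases j <;> simp
  have hd : d = -a := by linarith
  have h22 : S 2 2 = -1 := by
    rw [hd] at hdet
    linear_combination -hdet - S 2 2 * g00
  rw [h22, hd] at hSeq
  have hbc : b * c = 1 - a ^ 2 := by linear_combination g00
  -- The columns of Q are eigenvectors of the reflection. The general choice degenerates at a = -1,
  -- where bc = 0 and another choice is needed.
  by_cases ha : a = -1
  · refine ⟨!![b, -2, 0; 2, c, 0; 0, 0, 1], ?_, ?_, ?_⟩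
    · simp [Matrix.det_fin_three]
      rw [hbc, ha]
      norm_num
    · rw [hSeq]
      ext i j
      fin_cases i <;> fin_cases j <;>
        simp [Matrix.mul_apply, Fin.sum_univ_three, Matrix.diagonal_apply, ha, -mul_eq_zero] <;>
        rw [ha] at hbc <;> linarith
    · ext i j
      fin_cases i <;> fin_cases j <;> simp [Matrix.mul_apply, Matrix.diagonal_apply]
  · have ha' : 1 + a ≠ 0 := fun h => ha (by linarith)
    refine ⟨!![(1 + a) * (1 + a), -b, 0; (1 + a) * c, 1 + a, 0; 0, 0, 1], ?_, ?_, ?_⟩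
    · simp [Matrix.det_fin_three]
      have : (1 + a) * (1 + a) * (1 + a) + b * ((1 + a) * c) = 2 * (1 + a) ^ 2 := by
        linear_combination (1 + a) * hbc
      rw [this]
      positivity
    · rw [hSeq]
      ext i j
      fin_cases i <;> fin_cases j <;>
        simp [Matrix.mul_apply, Fin.sum_univ_three, Matrix.diagonal_apply, -mul_eq_zero] <;>
        first | linarith | linear_combination (1 + a) * hbc
    · ext i j
      fin_cases i <;> fin_cases j <;> simp [Matrix.mul_apply, Matrix.diagonal_apply]

/-- With equal coefficients the cyclic permutation of the axes is a symmetry, and its order is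
three. -/
theorem crossModel_square_ne_one {σ : ℝ}
    (h : ∀ S ∈ isotropy (crossModel σ σ σ), S * S = 1) : False := by
  obtain ⟨P, hP, hP1, hP2⟩ := exists_pullback_crossModel_cycle σ σ σ
  have h1 := congrArg (fun T : GL (Fin 3) ℝ => T.1 0 0) (h P ⟨hP, hP2⟩)
  have h2 := congrArg (fun T : GL (Fin 3) ℝ => T.1 0 1) (h P ⟨hP, hP2⟩)
  simp [hP1, Matrix.mul_apply, Fin.sum_univ_three] at h1 h2

theorem mul_self_isotropy_pullback {Γ : Christoffel 3} (h : ∀ S ∈ isotropy Γ, S * S = 1)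
    (P : GL (Fin 3) ℝ) : ∀ S ∈ isotropy (pullback P Γ), S * S = 1 := by
  intro S hS
  have hS' : P * S * P⁻¹ ∈ isotropy Γ := by
    rw [← conj_mem_isotropy_pullback P]
    simpa [mul_assoc] using hS
  have h1 : P * (S * S) * P⁻¹ = 1 := by
    rw [← h _ hS']
    group
  calc S * S = P⁻¹ * (P * (S * S) * P⁻¹) * P := by group
    _ = 1 := by rw [h1]; group

/-- An isotropy group of exponent two with more than two elements. -/
theorem exists_pullback_kleinModel {Γ : Christoffel 3} (hΓ : TorsionFree Γ)
    (hdet : (ricci Γ).det ≠ 0) (hinv : ∀ S ∈ isotropy Γ, S * S = 1) {T S : GL (Fin 3) ℝ}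
    (hT : T ∈ isotropy Γ) (hT1 : T.1 = Matrix.diagonal ![-1, -1, 1]) (hS : S ∈ isotropy Γ)
    (hS1 : S ≠ 1) (hST : S ≠ T) :
    ∃ P : GL (Fin 3) ℝ, 0 < P.1.det ∧ pullback P Γ = kleinModel := by
  -- A group of exponent two is abelian.
  have hcomm : S * T = T * S := by
    have h1 := hinv _ (mul_mem hS hT)
    have h2 := hinv _ hS
    have h3 := hinv _ hT
    rw [eq_inv_of_mul_eq_one_left h1, _root_.mul_inv_rev, inv_eq_of_mul_eq_one_right h2,
      inv_eq_of_mul_eq_one_right h3]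
  obtain ⟨Q, hQ, hSQ, hTQ⟩ := exists_simultaneous_diagonalization (S := S.1)
    (congrArg Units.val (hinv S hS)) (det_isotropy hdet hS)
    (by rw [← hT1]; exact congrArg Units.val hcomm) (fun h => hS1 (Units.ext h))
    (fun h => hST (Units.ext (h.trans hT1.symm)))
  set P : GL (Fin 3) ℝ := Matrix.GeneralLinearGroup.mkOfDetNeZero Q hQ.ne' with hPdef
  have hP : 0 < P.1.det := hQ
  have hSP : (P⁻¹ * S * P).1 = Matrix.diagonal ![1, -1, -1] := conj_val_eq hSQ
  have hTP : (P⁻¹ * T * P).1 = Matrix.diagonal ![-1, -1, 1] :=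
    conj_val_eq (by rw [hT1]; exact hTQ)
  obtain ⟨p, q, r, hpqr⟩ := eq_crossModel (hΓ.pullback P)
    ((conj_mem_isotropy_pullback P).2 hT) hTP ((conj_mem_isotropy_pullback P).2 hS) hSP
  have hric : (ricci (crossModel p q r)).det ≠ 0 := by
    rw [← hpqr, ricci_pullback, Matrix.det_mul, Matrix.det_mul, Matrix.det_transpose]
    exact mul_ne_zero (mul_ne_zero hP.ne' hdet) hP.ne'
  rw [ricci_crossModel, Matrix.det_diagonal, Fin.prod_univ_three] at hric
  have hp : p ≠ 0 := by rintro rfl; simp at hric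
  have hq : q ≠ 0 := by rintro rfl; simp at hric
  have hr : r ≠ 0 := by rintro rfl; simp at hric
  obtain ⟨R, hR, σ, τ, υ, hσ, hτ, hυ, hRe⟩ := exists_pullback_crossModel_sign hp hq hr
  have hPR : pullback (P * R) Γ = crossModel σ τ υ := by rw [pullback_mul, hpqr, hRe]
  by_cases hsame : σ = τ ∧ τ = υ
  · exfalso
    obtain ⟨rfl, rfl⟩ := hsame
    have := mul_self_isotropy_pullback hinv (P * R)
    rw [hPR] at this
    exact crossModel_square_ne_one this
  · obtain ⟨K, hK, hKe⟩ := exists_pullback_crossModel_klein hσ hτ hυ hsame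
    exact ⟨P * R * K, pullback_val_det_pos (pullback_val_det_pos hP hR) hK,
      by rw [pullback_mul, hPR, hKe]⟩

/-! ### Reduction to the normal forms -/

theorem det_ricci_pullback_ne_zero {Γ : Christoffel 3} (hdet : (ricci Γ).det ≠ 0)
    (P : GL (Fin 3) ℝ) : (ricci (pullback P Γ)).det ≠ 0 := by
  have hP : P.1.det ≠ 0 := (Matrix.isUnits_det_units P).ne_zero
  rw [ricci_pullback, Matrix.det_mul, Matrix.det_mul, Matrix.det_transpose]
  exact mul_ne_zero (mul_ne_zero hP hdet) hP

theorem triangularModel_zero (a b c d : ℝ) :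
    triangularModel a b c d 0 0 = rotationModel a b c d := by
  simp [triangularModel, rotationModel]

theorem hyperbolicModel_conditions {a b c d : ℝ} (h : (ricci (hyperbolicModel a b c d)).det ≠ 0) :
    a * d ≠ 0 ∧ -b ^ 2 + b * d + c * (-c + d) ≠ 0 := by
  rw [ricci_hyperbolicModel, Matrix.det_fin_three] at h
  constructor <;> intro h0 <;> simp [h0] at h

theorem rotationModel_conditions {a b c d : ℝ} (h : (ricci (rotationModel a b c d)).det ≠ 0) :
    a * d ≠ 0 ∧ b * d - b ^ 2 + c ^ 2 ≠ 0 := by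
  rw [ricci_rotationModel, Matrix.det_fin_three] at h
  constructor <;> intro h0 <;> simp [h0] at h

theorem orderThreeModel_conditions {a b c d : ℝ}
    (h : (ricci (orderThreeModel a b c d)).det ≠ 0) :
    a * d - 2 ≠ 0 ∧ -b ^ 2 + c ^ 2 + b * d ≠ 0 := by
  rw [ricci_orderThreeModel, Matrix.det_fin_three] at h
  constructor <;> intro h0
  · simp [h0] at h
  · have : b * d - b ^ 2 + c ^ 2 = 0 := by linear_combination h0
    simp [this] at h

/-- The normal forms in the presence of a symmetry that is not an involution. -/
theorem exists_pullback_of_mul_self_ne_one {Γ : Christoffel 3} (hΓ : TorsionFree Γ)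
    (hdet : (ricci Γ).det ≠ 0) {S : GL (Fin 3) ℝ} (hS : S ∈ isotropy Γ) (hS2 : S * S ≠ 1) :
    ∃ P : GL (Fin 3) ℝ, 0 < P.1.det ∧
      ((∃ a b c d, pullback P Γ = hyperbolicModel a b c d) ∨
        (∃ a b c d, pullback P Γ = rotationModel a b c d) ∨
        (∃ a b c d, pullback P Γ = orderThreeModel a b c d)) := by
  have hS1 : S ≠ 1 := by rintro rfl; exact hS2 (mul_one 1)
  obtain ⟨P, hP, h⟩ := exists_conj_normal_form hΓ hdet hS hS1
  have hmem := (conj_mem_isotropy_pullback P).2 hS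
  have hsq : (P⁻¹ * S * P).1 * (P⁻¹ * S * P).1 ≠ 1 := by
    intro h1
    have h2 : P⁻¹ * S * P * (P⁻¹ * S * P) = 1 := Units.ext h1
    apply hS2
    calc S * S = P * (P⁻¹ * S * P * (P⁻¹ * S * P)) * P⁻¹ := by group
      _ = 1 := by rw [h2]; group
  rcases h with ⟨t, ht, hN⟩ | ⟨p, q, hpq, hN⟩
  · refine ⟨P, hP, Or.inl (eq_hyperbolicModel (hΓ.pullback P) hmem ht (fun ht2 => hsq ?_) hN)⟩
    have ht3 : t⁻¹ * t⁻¹ = 1 := by rw [← mul_inv, ← sq, ht2, inv_one]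
    rw [hN]
    ext i j
    fin_cases i <;> fin_cases j <;> simp [Matrix.mul_apply, Fin.sum_univ_three, ← sq, ht2]
  · have hq : q ≠ 0 := by
      rintro rfl
      apply hsq
      rw [hN, rotation]
      ext i j
      fin_cases i <;> fin_cases j <;> simp [Matrix.mul_apply, Fin.sum_univ_three] <;> linarith
    obtain ⟨a, b, c, d, α, β, hm⟩ := eq_triangularModel (hΓ.pullback P) hmem hpq hq hN
    by_cases h0 : α = 0 ∧ β = 0
    · refine ⟨P, hP, Or.inr (Or.inl ⟨a, b, c, d, ?_⟩)⟩
      rw [hm, h0.1, h0.2, triangularModel_zero]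
    · obtain ⟨Q, hQ, a', hQ'⟩ := exists_pullback_triangularModel a b c d h0
      exact ⟨P * Q, pullback_val_det_pos hP hQ,
        Or.inr (Or.inr ⟨a', b, c, d, by rw [pullback_mul, hm, hQ']⟩)⟩

/-- A non-trivial involutive symmetry is a half turn. -/
theorem exists_conj_half_turn {Γ : Christoffel 3} (hΓ : TorsionFree Γ)
    (hdet : (ricci Γ).det ≠ 0) {T : GL (Fin 3) ℝ} (hT : T ∈ isotropy Γ) (hT1 : T ≠ 1)
    (hT2 : T * T = 1) :
    ∃ P : GL (Fin 3) ℝ, 0 < P.1.det ∧ (P⁻¹ * T * P).1 = Matrix.diagonal ![-1, -1, 1] := by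
  obtain ⟨P, hP, h⟩ := exists_conj_normal_form hΓ hdet hT hT1
  refine ⟨P, hP, ?_⟩
  have hsq : (P⁻¹ * T * P).1 * (P⁻¹ * T * P).1 = 1 := by
    rw [← Units.val_mul, show P⁻¹ * T * P * (P⁻¹ * T * P) = P⁻¹ * (T * T) * P by group, hT2]
    simp
  have hne : (P⁻¹ * T * P).1 ≠ 1 := by
    intro h1
    have h2 : P⁻¹ * T * P = 1 := Units.ext h1
    apply hT1
    calc T = P * (P⁻¹ * T * P) * P⁻¹ := by group
      _ = 1 := by rw [h2]; group
  rcases h with ⟨t, ht, hN⟩ | ⟨p, q, hpq, hN⟩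
  · rw [hN] at hsq hne ⊢
    have h00 := congrFun (congrFun hsq 0) 0
    simp [Matrix.mul_apply, Fin.sum_univ_three] at h00
    rcases mul_self_eq_one_iff.1 h00 with rfl | rfl
    · refine absurd ?_ hne
      ext i j
      fin_cases i <;> fin_cases j <;> simp
    · ext i j
      fin_cases i <;> fin_cases j <;> simp
  · rw [hN] at hsq hne ⊢
    have h00 := congrFun (congrFun hsq 0) 0
    simp [rotation, Matrix.mul_apply, Fin.sum_univ_three] at h00
    have hq : q = 0 := by
      have : q * q = 0 := by linarith
      simpa using this
    subst hq
    rcases mul_self_eq_one_iff.1 (by linarith : p * p = 1) with rfl | rfl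
    · refine absurd ?_ hne
      ext i j
      fin_cases i <;> fin_cases j <;> simp [rotation]
    · ext i j
      fin_cases i <;> fin_cases j <;> simp [rotation]

theorem nonempty_mulEquiv_zmod_of_card {G : Type*} [Group G] {p : ℕ} [Fact p.Prime]
    (h : Nat.card G = p) : Nonempty (G ≃* Multiplicative (ZMod p)) :=
  ⟨mulEquivOfPrimeCardEq h (by simp)⟩

/-- Every structure with non-trivial isotropy has one of the normal forms. -/
theorem exists_normal_form {Γ : Christoffel 3} (hΓ : TorsionFree Γ) (hdet : (ricci Γ).det ≠ 0)
    (hiso : isotropy Γ ≠ ⊥) :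
    ∃ T ∈ Matrix.GLPos (Fin 3) ℝ,
      (∃ a b c d : ℝ, a * d ≠ 0 ∧ -b ^ 2 + b * d + c * (-c + d) ≠ 0 ∧
        pullback T Γ = hyperbolicModel a b c d) ∨
      (∃ a b c d : ℝ, a * d ≠ 0 ∧ b * d - b ^ 2 + c ^ 2 ≠ 0 ∧
        pullback T Γ = rotationModel a b c d) ∨
      (∃ a b c d : ℝ, a * d - 2 ≠ 0 ∧ -b ^ 2 + c ^ 2 + b * d ≠ 0 ∧
        pullback T Γ = orderThreeModel a b c d) ∨
      pullback T Γ = kleinModel ∨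
      (∃ a b c d e f g h : ℝ,
        (ricci (orderTwoModel a b c d e f g h)).det ≠ 0 ∧
        pullback T Γ = orderTwoModel a b c d e f g h ∧
        Nonempty (isotropy (orderTwoModel a b c d e f g h) ≃* Multiplicative (ZMod 2))) := by
  by_cases hex : ∃ S ∈ isotropy Γ, S * S ≠ 1
  · obtain ⟨S, hS, hS2⟩ := hex
    obtain ⟨P, hP, h⟩ := exists_pullback_of_mul_self_ne_one hΓ hdet hS hS2
    have hdet' := det_ricci_pullback_ne_zero hdet P
    refine ⟨P, hP, ?_⟩
    rcases h with ⟨a, b, c, d, h⟩ | ⟨a, b, c, d, h⟩ | ⟨a, b, c, d, h⟩ <;> rw [h] at hdet'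
    · exact Or.inl ⟨a, b, c, d, (hyperbolicModel_conditions hdet').1,
        (hyperbolicModel_conditions hdet').2, h⟩
    · exact Or.inr (Or.inl ⟨a, b, c, d, (rotationModel_conditions hdet').1,
        (rotationModel_conditions hdet').2, h⟩)
    · exact Or.inr (Or.inr (Or.inl ⟨a, b, c, d, (orderThreeModel_conditions hdet').1,
        (orderThreeModel_conditions hdet').2, h⟩))
  · push Not at hex
    obtain ⟨⟨T, hT⟩, hT1⟩ := Subgroup.ne_bot_iff_exists_ne_one.1 hiso
    have hT1' : T ≠ 1 := fun h => hT1 (Subtype.ext h)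
    obtain ⟨P, hP, hD⟩ := exists_conj_half_turn hΓ hdet hT hT1' (hex T hT)
    have hmem := (conj_mem_isotropy_pullback P).2 hT
    set D := P⁻¹ * T * P with hDdef
    have hdet' := det_ricci_pullback_ne_zero hdet P
    -- Either a second involution leads to the Klein model, or the group is {1, D} of order two.
    by_cases hbig : ∃ S ∈ isotropy (pullback P Γ), S ≠ 1 ∧ S ≠ D
    · obtain ⟨S, hS, hS1, hSD⟩ := hbig
      obtain ⟨Q, hQ, hQ'⟩ := exists_pullback_kleinModel (hΓ.pullback P) hdet'
        (mul_self_isotropy_pullback hex P) hmem hD hS hS1 hSD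
      exact ⟨P * Q, pullback_val_det_pos hP hQ,
        Or.inr (Or.inr (Or.inr (Or.inl (by rw [pullback_mul, hQ']))))⟩
    · push Not at hbig
      obtain ⟨a, b, c, d, e, f, g, h, hm⟩ := eq_orderTwoModel (hΓ.pullback P) hmem hD
      have hD1 : D ≠ 1 := by
        intro h1
        rw [h1] at hD
        have := congrFun (congrFun hD 0) 0
        norm_num at this
      have hcard : Nat.card (isotropy (pullback P Γ)) = 2 := by
        refine Nat.card_eq_two_iff.2 ⟨1, ⟨D, hmem⟩, fun h => hD1 (congrArg Subtype.val h).symm, ?_⟩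
        ext ⟨S, hS⟩
        simp only [Set.mem_insert_iff, Set.mem_singleton_iff, Set.mem_univ, iff_true]
        by_cases hS1 : S = 1
        · exact Or.inl (Subtype.ext hS1)
        · exact Or.inr (Subtype.ext (hbig S hS hS1))
      rw [hm] at hcard hdet'
      exact ⟨P, hP, Or.inr (Or.inr (Or.inr (Or.inr ⟨a, b, c, d, e, f, g, h, hdet', hm,
        nonempty_mulEquiv_zmod_of_card hcard⟩)))⟩

/-! ### An endomorphism commuting with all symmetries -/

theorem triple_product_mulVec (M : Matrix (Fin 3) (Fin 3) ℝ) (x y w : Fin 3 → ℝ) :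
    (M *ᵥ w) ⬝ᵥ (M *ᵥ x) ⨯₃ (M *ᵥ y) = M.det * (w ⬝ᵥ x ⨯₃ y) := by
  have h : Matrix.of ![M *ᵥ w, M *ᵥ x, M *ᵥ y] = Matrix.of ![w, x, y] * Mᵀ := by
    ext i j
    fin_cases i <;> simp [Matrix.mul_apply, Matrix.mulVec, dotProduct, mul_comm]
  have h' := congrArg Matrix.det h
  rw [Matrix.det_mul, Matrix.det_transpose] at h'
  rw [triple_product_eq_det, triple_product_eq_det]
  exact h'.trans (mul_comm _ _)

/-- The antisymmetrised covariant derivative of the Ricci tensor. -/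
def cotton (Γ : Christoffel 3) (x y z : Fin 3 → ℝ) : ℝ :=
  product Γ y z ⬝ᵥ ricci Γ *ᵥ x - product Γ x z ⬝ᵥ ricci Γ *ᵥ y

theorem ricci_isotropy_apply {Γ : Christoffel 3} {T : GL (Fin 3) ℝ} (hT : T ∈ isotropy Γ)
    (x y : Fin 3 → ℝ) : (T.1 *ᵥ x) ⬝ᵥ ricci Γ *ᵥ (T.1 *ᵥ y) = x ⬝ᵥ ricci Γ *ᵥ y := by
  have h := ricci_isotropy hT
  conv_rhs => rw [← h]
  rw [← Matrix.mulVec_mulVec, ← Matrix.mulVec_mulVec, Matrix.dotProduct_mulVec x,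
    Matrix.vecMul_transpose]

theorem cotton_isotropy {Γ : Christoffel 3} {T : GL (Fin 3) ℝ} (hT : T ∈ isotropy Γ)
    (x y z : Fin 3 → ℝ) : cotton Γ (T.1 *ᵥ x) (T.1 *ᵥ y) (T.1 *ᵥ z) = cotton Γ x y z := by
  simp only [cotton, product_isotropy hT, ricci_isotropy_apply hT]

/-- The endomorphism that corresponds to `cotton` through the volume form is invariant. -/
theorem commute_of_cotton {Γ : Christoffel 3} (hdet : (ricci Γ).det ≠ 0)
    {B : Matrix (Fin 3) (Fin 3) ℝ} (hB : ∀ x y z, cotton Γ x y z = (B *ᵥ z) ⬝ᵥ x ⨯₃ y)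
    {T : GL (Fin 3) ℝ} (hT : T ∈ isotropy Γ) : B * T.1 = T.1 * B := by
  have hinv : T.1 * ((T⁻¹ : GL (Fin 3) ℝ) : Matrix (Fin 3) (Fin 3) ℝ) = 1 := T.mul_inv
  have key : ∀ z u v, (B *ᵥ (T.1 *ᵥ z)) ⬝ᵥ u ⨯₃ v = (T.1 *ᵥ (B *ᵥ z)) ⬝ᵥ u ⨯₃ v := by
    intro z u v
    obtain ⟨x, rfl⟩ : ∃ x, T.1 *ᵥ x = u :=
      ⟨((T⁻¹ : GL (Fin 3) ℝ) : Matrix (Fin 3) (Fin 3) ℝ) *ᵥ u, by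
        rw [Matrix.mulVec_mulVec, hinv, Matrix.one_mulVec]⟩
    obtain ⟨y, rfl⟩ : ∃ y, T.1 *ᵥ y = v :=
      ⟨((T⁻¹ : GL (Fin 3) ℝ) : Matrix (Fin 3) (Fin 3) ℝ) *ᵥ v, by
        rw [Matrix.mulVec_mulVec, hinv, Matrix.one_mulVec]⟩
    -- As det T = 1, the triple product is preserved, and invariance of the three-linear form passes
    -- to B.
    rw [← hB, cotton_isotropy hT, hB, triple_product_mulVec, det_isotropy hdet hT, one_mul]
  apply Matrix.ext_of_mulVec_single
  intro i
  rw [← Matrix.mulVec_mulVec, ← Matrix.mulVec_mulVec]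
  have h := key (Pi.single i 1)
  have h0 := h ![0, 1, 0] ![0, 0, 1]
  have h1 := h ![0, 0, 1] ![1, 0, 0]
  have h2 := h ![1, 0, 0] ![0, 1, 0]
  generalize B *ᵥ (T.1 *ᵥ Pi.single i 1) = u at *
  generalize T.1 *ᵥ (B *ᵥ Pi.single i 1) = v at *
  simp [cross_apply, dotProduct, Fin.sum_univ_three] at h0 h1 h2
  ext j
  fin_cases j <;> simp [h0, h1, h2]

/-! ### The first family -/

theorem cotton_hyperbolicModel (a b c d : ℝ) (x y z : Fin 3 → ℝ) :
    cotton (hyperbolicModel a b c d) x y z =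
      (Matrix.diagonal ![a * (b * d - (-b ^ 2 + b * d + c * (-c + d))),
        a * (-b ^ 2 + b * d + c * (-c + d) - c * d), a * d * (c - b)] *ᵥ z) ⬝ᵥ x ⨯₃ y := by
  rw [cotton, ricci_hyperbolicModel]
  simp [product, hyperbolicModel, ofMatrices, cross_apply, dotProduct, Fin.sum_univ_three,
    Matrix.mulVec, Matrix.diagonal_apply]
  ring

theorem det_ricci_hyperbolicModel {a b c d : ℝ} (h1 : a * d ≠ 0)
    (h2 : -b ^ 2 + b * d + c * (-c + d) ≠ 0) : (ricci (hyperbolicModel a b c d)).det ≠ 0 := by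
  rw [ricci_hyperbolicModel, Matrix.det_fin_three]
  simp only [Matrix.of_apply, Matrix.cons_val, zero_mul, mul_zero, sub_zero, add_zero, zero_sub]
  exact neg_ne_zero.2 (mul_ne_zero (mul_ne_zero h1 h1) h2)

/-- The trace form is (b + c + d)e^3. If it is not zero, invariance fixes the third row of T;
otherwise commutation with B separates the first two axes. The Ricci tensor and the determinant do
the rest. -/
theorem isotropy_hyperbolicModel {a b c d : ℝ} (h1 : a * d ≠ 0)
    (h2 : -b ^ 2 + b * d + c * (-c + d) ≠ 0) :
    (isotropy (hyperbolicModel a b c d) : Set (GL (Fin 3) ℝ)) = SO11 := by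
  have hdet := det_ricci_hyperbolicModel h1 h2
  ext T
  constructor
  · intro hT
    have hR := fun i j => congrFun (congrFun (ricci_isotropy hT) i) j
    have hD := det_isotropy hdet hT
    have hC := fun i j =>
      congrFun (congrFun (commute_of_cotton hdet (cotton_hyperbolicModel a b c d) hT) i) j
    have hW := traceForm_isotropy hT
    rw [ricci_hyperbolicModel] at hR
    simp only [Matrix.mul_apply, Fin.sum_univ_three, Matrix.transpose_apply] at hR hC
    have hW0 := hW 0
    have hW1 := hW 1
    have hW2 := hW 2
    have hC01 := hC 0 1
    have hC10 := hC 1 0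
    have r00 := hR 0 0
    have r01 := hR 0 1
    have r02 := hR 0 2
    have r11 := hR 1 1
    have r12 := hR 1 2
    have r22 := hR 2 2
    clear hR hC
    rw [Matrix.det_fin_three] at hD
    simp [traceForm, Matrix.trace, rightMul, hyperbolicModel, ofMatrices, Fin.sum_univ_three]
      at hW0 hW1 hW2
    simp at hC01 hC10
    simp at r00 r01 r02 r11 r12 r22
    have ha : a ≠ 0 := left_ne_zero_of_mul h1
    have hd : d ≠ 0 := right_ne_zero_of_mul h1
    set κ := -b ^ 2 + b * d + c * (-c + d) with hκ
    have hblock : T.1 2 0 = 0 ∧ T.1 2 1 = 0 ∧ T.1 0 1 = 0 ∧ T.1 1 0 = 0 := by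
      by_cases hω : b + c + d = 0
      -- The difference of the first two eigenvalues of B. For c = -b - d it equals a((2b + d)² +
      -- 2d²).
      · have hμ : a * (b * d + c * d - 2 * κ) ≠ 0 := by
          refine mul_ne_zero ha fun h0 => hd ?_
          have hc : c = -b - d := by linarith
          rw [hκ, hc] at h0
          nlinarith [sq_nonneg (2 * b + d), sq_nonneg d]
        have m01 : T.1 0 1 = 0 := by
          apply (mul_eq_zero.1 _).resolve_left hμ
          linear_combination hC01
        have m10 : T.1 1 0 = 0 := by
          apply (mul_eq_zero.1 _).resolve_left hμ
          linear_combination -hC10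
        simp [m01, m10, h2] at r00 r11
        exact ⟨r00, r11, m01, m10⟩
      · have m20 := hW0.resolve_right hω
        have m21 := hW1.resolve_right hω
        have m22 : T.1 2 2 = 1 := by
          apply mul_right_cancel₀ hω
          linear_combination hW2
        simp only [m20, m21, m22] at hD r01 r00 r11
        have hs : T.1 0 0 * T.1 1 1 + T.1 1 0 * T.1 0 1 = 1 := by
          apply mul_left_cancel₀ h1
          linear_combination r01
        -- The permanent and the determinant of the plane block are both 1.
        have hps : T.1 0 0 * T.1 1 1 = 1 := by linear_combination (hD + hs) / 2
        have hp := left_ne_zero_of_mul_eq_one hps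
        have hq := right_ne_zero_of_mul_eq_one hps
        have e0 : 2 * (a * d) * T.1 0 0 * T.1 1 0 = 0 := by linear_combination r00
        have e1 : 2 * (a * d) * T.1 1 1 * T.1 0 1 = 0 := by linear_combination r11
        refine ⟨m20, m21, ?_, ?_⟩
        · exact (mul_eq_zero.1 e1).resolve_left (mul_ne_zero (mul_ne_zero two_ne_zero h1) hq)
        · exact (mul_eq_zero.1 e0).resolve_left (mul_ne_zero (mul_ne_zero two_ne_zero h1) hp)
    obtain ⟨m20, m21, m01, m10⟩ := hblock
    simp only [m20, m21, m01, m10] at hD r01 r02 r12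
    have hps : T.1 0 0 * T.1 1 1 = 1 := by
      apply mul_left_cancel₀ h1
      linear_combination r01
    have hp := left_ne_zero_of_mul_eq_one hps
    have hq := right_ne_zero_of_mul_eq_one hps
    have m12 : T.1 1 2 = 0 :=
      (mul_eq_zero.1 (by linear_combination r02 : (a * d * T.1 0 0) * T.1 1 2 = 0)).resolve_left
        (mul_ne_zero h1 hp)
    have m02 : T.1 0 2 = 0 :=
      (mul_eq_zero.1 (by linear_combination r12 : (a * d * T.1 1 1) * T.1 0 2 = 0)).resolve_left
        (mul_ne_zero h1 hq)
    have m22 : T.1 2 2 = 1 := by linear_combination hD - T.1 2 2 * hps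
    refine ⟨T.1 0 0, hp, ?_⟩
    rw [inv_eq_of_mul_eq_one_right hps]
    ext i j
    fin_cases i <;> fin_cases j <;> simp [m20, m21, m01, m10, m02, m12, m22]
  · rintro ⟨t, ht, hN⟩
    refine ⟨?_, pullback_eq_of_val hN ?_⟩
    · change 0 < T.1.det
      rw [hN]
      simp [Matrix.det_fin_three, ht]
    · intro i j k
      fin_cases i <;> fin_cases j <;> fin_cases k <;>
        simp [Fin.sum_univ_three, hyperbolicModel, ofMatrices, ht]

/-! ### The second and the third family -/

theorem cotton_rotationModel (a b c d : ℝ) (x y z : Fin 3 → ℝ) :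
    cotton (rotationModel a b c d) x y z =
      (!![a * d * c, a * d * b - 2 * (b * d - b ^ 2 + c ^ 2) * a, 0;
        -(a * d * b - 2 * (b * d - b ^ 2 + c ^ 2) * a), a * d * c, 0;
        0, 0, -2 * (a * d * c)] *ᵥ z) ⬝ᵥ x ⨯₃ y := by
  rw [cotton, ricci_rotationModel]
  simp [product, rotationModel, ofMatrices, cross_apply, dotProduct, Fin.sum_univ_three,
    Matrix.mulVec]
  ring

theorem cotton_orderThreeModel (a b c d : ℝ) (x y z : Fin 3 → ℝ) :
    cotton (orderThreeModel a b c d) x y z =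
      (!![(a * d - 2) * c, (a * d - 2) * b - 2 * (b * d - b ^ 2 + c ^ 2) * a, 0;
        -((a * d - 2) * b - 2 * (b * d - b ^ 2 + c ^ 2) * a), (a * d - 2) * c, 0;
        0, 0, -2 * ((a * d - 2) * c)] *ᵥ z) ⬝ᵥ x ⨯₃ y := by
  rw [cotton, ricci_orderThreeModel]
  simp [product, orderThreeModel, ofMatrices, cross_apply, dotProduct, Fin.sum_univ_three,
    Matrix.mulVec]
  ring

/-- An isometry of determinant one that fixes the third axis is a rotation or reverses the axis. -/
theorem rotation_of_axis {M : Matrix (Fin 3) (Fin 3) ℝ} {A κ : ℝ} (hA : A ≠ 0) (hκ : κ ≠ 0)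
    (hM : Mᵀ * !![A, 0, 0; 0, A, 0; 0, 0, κ] * M = !![A, 0, 0; 0, A, 0; 0, 0, κ])
    (hdet : M.det = 1) (h02 : M 0 2 = 0) (h12 : M 1 2 = 0) :
    (∃ p q, p ^ 2 + q ^ 2 = 1 ∧ M = rotation p q) ∨
      ∃ p q, p ^ 2 + q ^ 2 = 1 ∧ M = !![p, q, 0; q, -p, 0; 0, 0, -1] := by
  have e := fun i j => congrFun (congrFun hM i) j
  simp only [Matrix.mul_apply, Fin.sum_univ_three, Matrix.transpose_apply] at e
  have e00 := e 0 0
  have e01 := e 0 1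
  have e02 := e 0 2
  have e11 := e 1 1
  have e12 := e 1 2
  have e22 := e 2 2
  simp [h02, h12] at e00 e01 e02 e11 e12 e22
  have hz : M 2 2 * M 2 2 = 1 := by
    apply mul_left_cancel₀ hκ
    linear_combination e22
  have hz0 : M 2 2 ≠ 0 := left_ne_zero_of_mul_eq_one hz
  simp [hκ, hz0] at e02 e12
  simp [e02, e12] at e00 e01 e11
  have g00 : M 0 0 ^ 2 + M 1 0 ^ 2 = 1 := by
    apply mul_left_cancel₀ hA
    linear_combination e00
  have g01 : M 0 0 * M 0 1 + M 1 0 * M 1 1 = 0 := by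
    apply mul_left_cancel₀ hA
    linear_combination e01
  rw [Matrix.det_fin_three] at hdet
  simp only [h02, h12, e02, e12] at hdet
  -- The plane block is orthogonal with determinant `M 2 2` = ±1, and its inverse is compared with
  -- its adjugate.
  have hs : M 1 1 = M 2 2 * M 0 0 := by
    linear_combination (-M 1 1) * g00 + M 1 0 * g01 + M 2 2 * M 0 0 * hdet +
      (M 0 0 * M 0 1 * M 1 0 - M 0 0 ^ 2 * M 1 1) * hz
  have hq : M 0 1 = -(M 2 2 * M 1 0) := by
    linear_combination (-M 0 1) * g00 + M 0 0 * g01 - M 2 2 * M 1 0 * hdet +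
      (M 0 0 * M 1 1 * M 1 0 - M 1 0 ^ 2 * M 0 1) * hz
  rcases mul_self_eq_one_iff.1 hz with h | h
  · refine Or.inl ⟨M 0 0, M 1 0, g00, ?_⟩
    ext i j
    fin_cases i <;> fin_cases j <;> simp [rotation, h02, h12, e02, e12, h, hs, hq]
  · refine Or.inr ⟨M 0 0, M 1 0, g00, ?_⟩
    ext i j
    fin_cases i <;> fin_cases j <;> simp [h02, h12, e02, e12, h, hs, hq]

/-- The eigenvalues are p ± im on the plane and -2p on the axis. They differ, since |3p + im|² = 9p²
+ m² ≠ 0, so a commuting map preserves the axis. -/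
theorem axis_of_commute {M : Matrix (Fin 3) (Fin 3) ℝ} {p m : ℝ} (h : p ≠ 0 ∨ m ≠ 0)
    (hM : !![p, m, 0; -m, p, 0; 0, 0, -2 * p] * M = M * !![p, m, 0; -m, p, 0; 0, 0, -2 * p]) :
    M 0 2 = 0 ∧ M 1 2 = 0 := by
  have e02 := congrFun (congrFun hM 0) 2
  have e12 := congrFun (congrFun hM 1) 2
  simp [Matrix.mul_apply, Fin.sum_univ_three] at e02 e12
  have hpos : 9 * p ^ 2 + m ^ 2 ≠ 0 := by
    rcases h with h | h <;> positivity
  constructor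
  · apply (mul_eq_zero.1 _).resolve_left hpos
    linear_combination 3 * p * e02 - m * e12
  · apply (mul_eq_zero.1 _).resolve_left hpos
    linear_combination 3 * p * e12 + m * e02

/-- The image of e₃ has norm κ, so its plane component is null for a definite form. -/
theorem axis_of_traceForm {M : Matrix (Fin 3) (Fin 3) ℝ} {A κ : ℝ} (hA : A ≠ 0)
    (hM : Mᵀ * !![A, 0, 0; 0, A, 0; 0, 0, κ] * M = !![A, 0, 0; 0, A, 0; 0, 0, κ])
    (h22 : M 2 2 = 1) : M 0 2 = 0 ∧ M 1 2 = 0 := by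
  have e := congrFun (congrFun hM 2) 2
  simp [Matrix.mul_apply, Fin.sum_univ_three, h22] at e
  have : M 0 2 * M 0 2 + M 1 2 * M 1 2 = 0 := by
    apply mul_left_cancel₀ hA
    linear_combination e
  constructor <;> nlinarith [mul_self_nonneg (M 0 2), mul_self_nonneg (M 1 2)]

theorem det_ricci_rotationModel {a b c d : ℝ} (h1 : a * d ≠ 0)
    (h2 : b * d - b ^ 2 + c ^ 2 ≠ 0) : (ricci (rotationModel a b c d)).det ≠ 0 := by
  rw [ricci_rotationModel, Matrix.det_fin_three]
  simp only [Matrix.of_apply, Matrix.cons_val, zero_mul, mul_zero, sub_zero, add_zero]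
  exact mul_ne_zero (mul_ne_zero h1 h1) (mul_ne_zero two_ne_zero h2)

theorem det_ricci_orderThreeModel {a b c d : ℝ} (h1 : a * d - 2 ≠ 0)
    (h2 : b * d - b ^ 2 + c ^ 2 ≠ 0) : (ricci (orderThreeModel a b c d)).det ≠ 0 := by
  rw [ricci_orderThreeModel, Matrix.det_fin_three]
  simp only [Matrix.of_apply, Matrix.cons_val, zero_mul, mul_zero, sub_zero, add_zero]
  exact mul_ne_zero (mul_ne_zero h1 h1) (mul_ne_zero two_ne_zero h2)

theorem axis_rotationModel {a b c d : ℝ} (h1 : a * d ≠ 0) (h2 : b * d - b ^ 2 + c ^ 2 ≠ 0)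
    {T : GL (Fin 3) ℝ} (hT : T ∈ isotropy (rotationModel a b c d)) :
    T.1 0 2 = 0 ∧ T.1 1 2 = 0 := by
  have hdet := det_ricci_rotationModel h1 h2
  by_cases hω : 2 * b + d = 0
  · refine axis_of_commute ?_ (commute_of_cotton hdet (cotton_rotationModel a b c d) hT)
    by_contra! h
    have hc : c = 0 := (mul_eq_zero.1 h.1).resolve_left h1
    have hd : d = -2 * b := by linarith
    have ha : a ≠ 0 := left_ne_zero_of_mul h1
    have hb : b ≠ 0 := by
      rintro rfl
      simp [hd] at h1
    have h3 := h.2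
    rw [hc, hd] at h3
    -- The value of the off-diagonal entry of B for c = 0, d = -2b.
    have : 4 * a * b ^ 2 = 0 := by linear_combination h3
    simp [ha, hb] at this
  · have hW := traceForm_isotropy hT 2
    have hR := ricci_isotropy hT
    rw [ricci_rotationModel] at hR
    refine axis_of_traceForm h1 hR ?_
    simp [traceForm, Matrix.trace, rightMul, rotationModel, ofMatrices, Fin.sum_univ_three] at hW
    apply mul_right_cancel₀ hω
    linear_combination hW

theorem isotropy_rotationModel {a b c d : ℝ} (h1 : a * d ≠ 0)
    (h2 : b * d - b ^ 2 + c ^ 2 ≠ 0) :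
    (isotropy (rotationModel a b c d) : Set (GL (Fin 3) ℝ)) = SO2 := by
  have hdet := det_ricci_rotationModel h1 h2
  ext T
  constructor
  · intro hT
    obtain ⟨h02, h12⟩ := axis_rotationModel h1 h2 hT
    have hR := ricci_isotropy hT
    rw [ricci_rotationModel] at hR
    rcases rotation_of_axis h1 (mul_ne_zero two_ne_zero h2) hR (det_isotropy hdet hT) h02 h12
      with ⟨p, q, hpq, hM⟩ | ⟨p, q, hpq, hM⟩
    · obtain ⟨θ, hp, hq⟩ : ∃ θ, p = Real.cos θ ∧ q = Real.sin θ := by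
        have hn : ‖(⟨p, q⟩ : ℂ)‖ = 1 := by
          rw [Complex.norm_eq_sqrt_sq_add_sq, hpq, Real.sqrt_one]
        have h0 : (⟨p, q⟩ : ℂ) ≠ 0 := by
          rw [← norm_ne_zero_iff, hn]
          exact one_ne_zero
        exact ⟨Complex.arg ⟨p, q⟩, by rw [Complex.cos_arg h0, hn, div_one],
          by rw [Complex.sin_arg, hn, div_one]⟩
      -- The matrices in `SO2` and `rotation` turn in opposite directions.
      refine ⟨-θ, ?_⟩
      rw [hM, hp, hq, rotation]
      simp
    -- Reversing the axis changes the sign of Γ_33^3 = d ≠ 0.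
    · have e := isotropy_apply_fin hT hM 2 2 2
      simp [Fin.sum_univ_three, rotationModel, ofMatrices] at e
      have hd : d ≠ 0 := right_ne_zero_of_mul h1
      exact absurd (by linarith) hd
  · rintro ⟨θ, hN⟩
    have hθ := Real.sin_sq_add_cos_sq θ
    refine ⟨?_, pullback_eq_of_val hN ?_⟩
    · change 0 < T.1.det
      rw [hN]
      simp [Matrix.det_fin_three]
      nlinarith
    · intro i j k
      fin_cases i <;> fin_cases j <;> fin_cases k <;>
        simp [Fin.sum_univ_three, rotationModel, ofMatrices, -mul_eq_mul_left_iff,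
          -mul_eq_mul_right_iff] <;> first | ring1 | linear_combination a * hθ

/-! ### The Klein model -/

theorem diagonal_mem_isotropy_crossModel {T : GL (Fin 3) ℝ} {x y : ℝ} (hx : x * x = 1)
    (hy : y * y = 1) (hT : T.1 = Matrix.diagonal ![x, y, x * y]) (p q r : ℝ) :
    T ∈ isotropy (crossModel p q r) := by
  refine ⟨?_, pullback_eq_of_val hT ?_⟩
  · change 0 < T.1.det
    have : x * y * (x * y) = 1 := by linear_combination y * y * hx + hy
    rw [hT, Matrix.det_diagonal, Fin.prod_univ_three]
    simp [this]
  · intro i j k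
    fin_cases i <;> fin_cases j <;> fin_cases k <;>
      simp [crossModel, ofMatrices, Matrix.diagonal_apply,
        -mul_eq_mul_left_iff, -mul_eq_mul_right_iff] <;>
      first | ring1 | linear_combination y * q * hx | linear_combination x * r * hy

/-- Vectors with x ∘ x = 0 are multiples of the basis vectors, so T sends e₁ and e₂ to coordinate
axes. The signature of ρ keeps the first axis apart from the others, Te₃ is the product of Te₁ and
Te₂, and the determinant excludes the exchange of the last two axes. -/
theorem exists_of_mem_isotropy_kleinModel {T : GL (Fin 3) ℝ} (hT : T ∈ isotropy kleinModel) :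
    ∃ x y : ℝ, x * x = 1 ∧ y * y = 1 ∧ T.1 = Matrix.diagonal ![x, y, x * y] := by
  have hdet : (ricci kleinModel).det ≠ 0 := by
    rw [ricci_kleinModel, Matrix.det_fin_three]
    simp
  have hD := det_isotropy hdet hT
  have hR := fun i j => congrFun (congrFun (ricci_isotropy hT) i) j
  rw [ricci_kleinModel] at hR
  simp only [Matrix.mul_apply, Fin.sum_univ_three, Matrix.transpose_apply] at hR
  have r00 := hR 0 0
  have r11 := hR 1 1
  have e := isotropy_apply hT
  simp only [Fin.sum_univ_three] at e
  have e000 := e 0 0 0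
  have e001 := e 0 0 1
  have e002 := e 0 0 2
  have e110 := e 1 1 0
  have e111 := e 1 1 1
  have e112 := e 1 1 2
  have e010 := e 0 1 0
  have e011 := e 0 1 1
  have e012 := e 0 1 2
  rw [Matrix.det_fin_three] at hD
  clear e hR
  simp at r00 r11
  simp [kleinModel, ofMatrices, -mul_eq_mul_left_iff, -mul_eq_mul_right_iff] at e000 e001 e002
  simp [kleinModel, ofMatrices, -mul_eq_mul_left_iff, -mul_eq_mul_right_iff] at e110 e111 e112
  simp [kleinModel, ofMatrices, -mul_eq_mul_left_iff, -mul_eq_mul_right_iff] at e010 e011 e012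
  have h00 : T.1 0 0 ≠ 0 := by
    intro h
    rw [h] at r00
    nlinarith [mul_self_nonneg (T.1 1 0), mul_self_nonneg (T.1 2 0)]
  have m20 : T.1 2 0 = 0 :=
    (mul_eq_zero.1 (by linear_combination e001 / 2 : T.1 0 0 * T.1 2 0 = 0)).resolve_left h00
  have m10 : T.1 1 0 = 0 :=
    (mul_eq_zero.1 (by linear_combination e002 / 2 : T.1 0 0 * T.1 1 0 = 0)).resolve_left h00
  have m01 : T.1 0 1 = 0 := by
    by_contra h01
    have m21 : T.1 2 1 = 0 :=
      (mul_eq_zero.1 (by linear_combination e111 / 2 : T.1 0 1 * T.1 2 1 = 0)).resolve_left h01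
    have m11 : T.1 1 1 = 0 :=
      (mul_eq_zero.1 (by linear_combination e112 / 2 : T.1 0 1 * T.1 1 1 = 0)).resolve_left h01
    rw [m21, m11] at r11
    nlinarith [mul_self_nonneg (T.1 0 1)]
  simp only [m20, m10, m01] at hD r00 r11 e010 e011 e012
  have hx : T.1 0 0 * T.1 0 0 = 1 := by linear_combination -r00 / 2
  have m02 : T.1 0 2 = 0 := by linear_combination -e010
  have m12 : T.1 1 2 = T.1 0 0 * T.1 2 1 := by linear_combination -e011
  have m22 : T.1 2 2 = T.1 0 0 * T.1 1 1 := by linear_combination -e012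
  rw [m12, m22] at hD
  have hdiff : T.1 1 1 * T.1 1 1 - T.1 2 1 * T.1 2 1 = 1 := by
    linear_combination hD - (T.1 1 1 * T.1 1 1 - T.1 2 1 * T.1 2 1) * hx
  have m21 : T.1 2 1 = 0 := by
    have : T.1 2 1 * T.1 2 1 = 0 := by linear_combination (r11 / 2 - hdiff) / 2
    simpa using this
  refine ⟨T.1 0 0, T.1 1 1, hx, by rw [m21] at hdiff; linear_combination hdiff, ?_⟩
  ext i j
  fin_cases i <;> fin_cases j <;> simp [m20, m10, m01, m02, m12, m22, m21]

/-- The diagonal matrix with entries `u`, `v`, `uv` for signs `u`, `v`. -/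
noncomputable def signDiagonal (u v : ℤˣ) : GL (Fin 3) ℝ :=
  Matrix.GeneralLinearGroup.mkOfDetNeZero
    (Matrix.diagonal ![((u : ℤ) : ℝ), ((v : ℤ) : ℝ), ((u : ℤ) : ℝ) * ((v : ℤ) : ℝ)]) (by
      rw [Matrix.det_diagonal, Fin.prod_univ_three]
      simp)

theorem card_isotropy_kleinModel : Nat.card (isotropy kleinModel) = 4 := by
  have hsq : ∀ u : ℤˣ, ((u : ℤ) : ℝ) * ((u : ℤ) : ℝ) = 1 := by
    intro u
    rcases Int.units_eq_one_or u with rfl | rfl <;> simp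
  have hex : ∀ x : ℝ, x * x = 1 → ∃ u : ℤˣ, ((u : ℤ) : ℝ) = x := by
    intro x hx
    rcases mul_self_eq_one_iff.1 hx with rfl | rfl
    · exact ⟨1, by simp⟩
    · exact ⟨-1, by simp⟩
  let f : ℤˣ × ℤˣ → isotropy kleinModel := fun u =>
    ⟨signDiagonal u.1 u.2,
      diagonal_mem_isotropy_crossModel (hsq u.1) (hsq u.2) rfl 1 1 (-1)⟩
  have hf : Function.Bijective f := by
    constructor
    · rintro ⟨u, v⟩ ⟨u', v'⟩ h
      have h' : (signDiagonal u v).1 = (signDiagonal u' v').1 :=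
        congrArg (fun T : isotropy kleinModel => T.1.1) h
      have h0 := congrFun (congrFun h' 0) 0
      have h1 := congrFun (congrFun h' 1) 1
      simp [signDiagonal] at h0 h1
      rw [Units.ext h0, Units.ext h1]
    · rintro ⟨T, hT⟩
      obtain ⟨x, y, hx, hy, hxy⟩ := exists_of_mem_isotropy_kleinModel hT
      obtain ⟨u, rfl⟩ := hex x hx
      obtain ⟨v, rfl⟩ := hex y hy
      exact ⟨(u, v), Subtype.ext (Units.ext hxy.symm)⟩
  rw [← Nat.card_congr (Equiv.ofBijective f hf)]
  simp

theorem nonempty_mulEquiv_kleinModel :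
    Nonempty (isotropy kleinModel ≃* Multiplicative (ZMod 2 × ZMod 2)) := by
  have hsq : ∀ T : isotropy kleinModel, T ^ 2 = 1 := by
    rintro ⟨T, hT⟩
    obtain ⟨x, y, hx, hy, hxy⟩ := exists_of_mem_isotropy_kleinModel hT
    apply Subtype.ext
    apply Units.ext
    change (T ^ 2).1 = 1
    have h2 : x * y * (x * y) = 1 := by linear_combination y * y * hx + hy
    rw [sq, Units.val_mul, hxy, Matrix.diagonal_mul_diagonal, ← Matrix.diagonal_one]
    congr 1
    funext i
    fin_cases i <;> simp [hx, hy, h2]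
  have hK : IsKleinFour (isotropy kleinModel) := by
    refine ⟨card_isotropy_kleinModel, ?_⟩
    have hdvd : Monoid.exponent (isotropy kleinModel) ∣ 2 :=
      Monoid.exponent_dvd_of_forall_pow_eq_one hsq
    rcases (Nat.dvd_prime Nat.prime_two).1 hdvd with h | h
    · have := (Monoid.exp_eq_one_iff.1 h)
      have hc := card_isotropy_kleinModel
      rw [Nat.card_eq_one_iff_unique.2 ⟨this, ⟨1⟩⟩] at hc
      norm_num at hc
    · exact h
  exact IsKleinFour.nonempty_mulEquiv

/-! ### Permutations of idempotents -/

/-- The symmetries of a structure permute the idempotents of its algebra. -/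
theorem exists_hom_perm {m n : ℕ} {Γ : Christoffel m} {p : Fin n → Fin m → ℝ}
    (hp : Function.Injective p)
    (hidem : ∀ x, (x ≠ 0 ∧ product Γ x x = x) ↔ ∃ i, p i = x) :
    ∃ φ : isotropy Γ →* Equiv.Perm (Fin n), ∀ T i, T.1.1 *ᵥ p i = p (φ T i) := by
  have hex : ∀ (T : isotropy Γ) i, ∃ j, p j = T.1.1 *ᵥ p i := by
    intro T i
    obtain ⟨h0, hi⟩ := (hidem (p i)).2 ⟨i, rfl⟩
    refine (hidem _).1 ⟨fun h => h0 ?_, by rw [product_isotropy T.2, hi]⟩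
    have hinv : ((T.1⁻¹ : GL (Fin m) ℝ) : Matrix (Fin m) (Fin m) ℝ) * T.1.1 = 1 := T.1.inv_mul
    rw [← Matrix.one_mulVec (p i), ← hinv, ← Matrix.mulVec_mulVec, h, Matrix.mulVec_zero]
  choose g hg using hex
  let act : MulAction (isotropy Γ) (Fin n) :=
    { smul := g
      one_smul := fun i => hp (by
        change p (g 1 i) = p i
        rw [hg]
        exact Matrix.one_mulVec _)
      mul_smul := fun S T i => hp (by
        change p (g (S * T) i) = p (g S (g T i))
        rw [hg, hg, hg, Matrix.mulVec_mulVec]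
        rfl) }
  exact ⟨MulAction.toPermHom (isotropy Γ) (Fin n), fun T i => (hg T i).symm⟩

/-! ### The tetrahedral structure -/

/-- The vertices of a regular tetrahedron, up to the factor `1/2`. -/
def tetrahedronSign : Fin 4 → Fin 3 → ℤ :=
  ![![1, 1, 1], ![1, -1, -1], ![-1, 1, -1], ![-1, -1, 1]]

/-- The idempotents of the algebra of `crossModel 1 1 1`. -/
noncomputable def tetrahedron (i : Fin 4) (k : Fin 3) : ℝ := (tetrahedronSign i k : ℝ) / 2

theorem tetrahedron_injective : Function.Injective tetrahedron := by
  have h : ∀ i j, (∀ k, tetrahedronSign i k = tetrahedronSign j k) → i = j := by decide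
  intro i j hij
  refine h i j fun k => ?_
  have := congrFun hij k
  simp only [tetrahedron] at this
  exact_mod_cast (div_left_inj' (two_ne_zero' ℝ)).1 this

theorem idempotent_crossModel_iff (x : Fin 3 → ℝ) :
    (x ≠ 0 ∧ product (crossModel 1 1 1) x x = x) ↔ ∃ i, tetrahedron i = x := by
  constructor
  · rintro ⟨h0, h⟩
    have h1 := congrFun h 0
    have h2 := congrFun h 1
    have h3 := congrFun h 2
    simp [product, crossModel, ofMatrices, Fin.sum_univ_three] at h1 h2 h3
    have hx : x 0 ≠ 0 := by
      intro hx
      rw [hx] at h2 h3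
      apply h0
      funext i
      fin_cases i
      · exact hx
      · simpa using h2.symm
      · simpa using h3.symm
    -- The equations x₁ = 2x₂x₃ and its cyclic shifts give x₁² = x₂² = x₃² = 2x₁x₂x₃.
    have h12 : (x 1 - x 0) * (x 1 + x 0) = 0 := by
      linear_combination x 0 * h1 - x 1 * h2
    have h13 : (x 2 - x 0) * (x 2 + x 0) = 0 := by
      linear_combination x 0 * h1 - x 2 * h3
    rcases mul_eq_zero.1 h12 with ha | ha <;> rcases mul_eq_zero.1 h13 with hb | hb
    · have e1 : x 1 = x 0 := by linarith
      have e2 : x 2 = x 0 := by linarith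
      rw [e1, e2] at h1
      have : x 0 = 1 / 2 := by apply mul_left_cancel₀ hx; linear_combination h1 / 2
      exact ⟨0, by funext i; fin_cases i <;> simp [tetrahedron, tetrahedronSign, e1, e2, this]⟩
    · have e1 : x 1 = x 0 := by linarith
      have e2 : x 2 = -x 0 := by linarith
      rw [e1, e2] at h1
      have : x 0 = -1 / 2 := by apply mul_left_cancel₀ hx; linear_combination -h1 / 2
      exact ⟨3, by
        funext i; fin_cases i <;> simp [tetrahedron, tetrahedronSign, e1, e2, this] <;> norm_num⟩
    · have e1 : x 1 = -x 0 := by linarith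
      have e2 : x 2 = x 0 := by linarith
      rw [e1, e2] at h1
      have : x 0 = -1 / 2 := by apply mul_left_cancel₀ hx; linear_combination -h1 / 2
      exact ⟨2, by
        funext i; fin_cases i <;> simp [tetrahedron, tetrahedronSign, e1, e2, this] <;> norm_num⟩
    · have e1 : x 1 = -x 0 := by linarith
      have e2 : x 2 = -x 0 := by linarith
      rw [e1, e2] at h1
      have : x 0 = 1 / 2 := by apply mul_left_cancel₀ hx; linear_combination h1 / 2
      exact ⟨1, by
        funext i; fin_cases i <;> simp [tetrahedron, tetrahedronSign, e1, e2, this] <;> norm_num⟩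
  · rintro ⟨i, rfl⟩
    constructor
    · intro h
      have h1 := congrFun h 0
      fin_cases i <;> simp [tetrahedron, tetrahedronSign] at h1
    · funext k
      fin_cases i <;> fin_cases k <;>
        simp [product, crossModel, ofMatrices, Fin.sum_univ_three, tetrahedron,
          tetrahedronSign] <;> norm_num

/-- Makes a symmetry of determinant 1 act on the four vertices by an even permutation. -/
theorem tetrahedron_det (σ : Equiv.Perm (Fin 4)) :
    (ofColumns (tetrahedron (σ 0)) (tetrahedron (σ 1)) (tetrahedron (σ 2))).det =
      ((Equiv.Perm.sign σ : ℤ) : ℝ) / 2 := by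
  have h : ∀ σ : Equiv.Perm (Fin 4),
      tetrahedronSign (σ 0) 0 * (tetrahedronSign (σ 1) 1 * tetrahedronSign (σ 2) 2 -
          tetrahedronSign (σ 1) 2 * tetrahedronSign (σ 2) 1) +
        tetrahedronSign (σ 0) 1 * (tetrahedronSign (σ 1) 2 * tetrahedronSign (σ 2) 0 -
          tetrahedronSign (σ 1) 0 * tetrahedronSign (σ 2) 2) +
        tetrahedronSign (σ 0) 2 * (tetrahedronSign (σ 1) 0 * tetrahedronSign (σ 2) 1 -
          tetrahedronSign (σ 1) 1 * tetrahedronSign (σ 2) 0) =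
      4 * (Equiv.Perm.sign σ : ℤ) := by decide
  have h' : ((_ : ℤ) : ℝ) = _ := congrArg (Int.cast (R := ℝ)) (h σ)
  push_cast at h'
  rw [det_ofColumns]
  simp [cross_apply, dotProduct, Fin.sum_univ_three, tetrahedron]
  linear_combination h' / 8

theorem mulVec_ofColumns (M : Matrix (Fin 3) (Fin 3) ℝ) (u v w : Fin 3 → ℝ) :
    M * ofColumns u v w = ofColumns (M *ᵥ u) (M *ᵥ v) (M *ᵥ w) := by
  ext i j
  fin_cases j <;> simp [ofColumns, Matrix.mul_apply, Matrix.mulVec, dotProduct]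

theorem det_ricci_crossModel : (ricci (crossModel 1 1 1)).det ≠ 0 := by
  rw [ricci_crossModel, Matrix.det_diagonal, Fin.prod_univ_three]
  simp

theorem isotropy_kleinModel_le : isotropy kleinModel ≤ isotropy (crossModel 1 1 1) := by
  intro T hT
  obtain ⟨x, y, hx, hy, hxy⟩ := exists_of_mem_isotropy_kleinModel hT
  exact diagonal_mem_isotropy_crossModel hx hy hxy 1 1 1

/-- The action on the idempotents embeds the group in a₄, since three of them span ℝ³. It is onto
because the order is divisible by 4, from the diagonal symmetries, and by 3, from the cyclic one. -/
theorem nonempty_mulEquiv_crossModel :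
    Nonempty (isotropy (crossModel 1 1 1) ≃* alternatingGroup (Fin 4)) := by
  obtain ⟨φ, hφ⟩ := exists_hom_perm tetrahedron_injective idempotent_crossModel_iff
  have hbase : (ofColumns (tetrahedron 0) (tetrahedron 1) (tetrahedron 2)).det = 1 / 2 := by
    simpa using tetrahedron_det 1
  have hsign : ∀ T, φ T ∈ alternatingGroup (Fin 4) := by
    intro T
    rw [Equiv.Perm.mem_alternatingGroup]
    have h1 := tetrahedron_det (φ T)
    rw [← hφ, ← hφ, ← hφ, ← mulVec_ofColumns, Matrix.det_mul, hbase,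
      det_isotropy det_ricci_crossModel T.2] at h1
    rcases Int.units_eq_one_or (Equiv.Perm.sign (φ T)) with h | h
    · exact h
    · rw [h] at h1
      norm_num at h1
  let ψ : isotropy (crossModel 1 1 1) →* alternatingGroup (Fin 4) := φ.codRestrict _ hsign
  have hψ : Function.Injective ψ := by
    rw [injective_iff_map_eq_one]
    intro T hT
    have hT' : φ T = 1 := congrArg Subtype.val hT
    have h1 : T.1.1 * ofColumns (tetrahedron 0) (tetrahedron 1) (tetrahedron 2) =
        ofColumns (tetrahedron 0) (tetrahedron 1) (tetrahedron 2) := by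
      rw [mulVec_ofColumns, hφ, hφ, hφ, hT']
      rfl
    have hu : IsUnit (ofColumns (tetrahedron 0) (tetrahedron 1) (tetrahedron 2)) := by
      rw [Matrix.isUnit_iff_isUnit_det, hbase]
      exact isUnit_iff_ne_zero.2 (by norm_num)
    apply Subtype.ext
    apply Units.ext
    exact hu.mul_left_injective (h1.trans (Matrix.one_mul _).symm)
  have hfin : Finite (isotropy (crossModel 1 1 1)) := Finite.of_injective ψ hψ
  have hA4 : Nat.card (alternatingGroup (Fin 4)) = 12 := by
    have h := two_mul_nat_card_alternatingGroup (α := Fin 4)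
    rw [Nat.card_perm, Nat.card_fin] at h
    have h24 : Nat.factorial 4 = 24 := rfl
    omega
  have h4 : 4 ∣ Nat.card (isotropy (crossModel 1 1 1)) := by
    rw [← card_isotropy_kleinModel]
    exact Subgroup.card_dvd_of_le isotropy_kleinModel_le
  have h3 : 3 ∣ Nat.card (isotropy (crossModel 1 1 1)) := by
    obtain ⟨P, hP, hP1, hP2⟩ := exists_pullback_crossModel_cycle 1 1 1
    have hmem : P ∈ isotropy (crossModel 1 1 1) := ⟨hP, hP2⟩
    have hord : orderOf P = 3 := by
      refine orderOf_eq_prime ?_ ?_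
      · apply Units.ext
        rw [pow_succ, sq, Units.val_mul, Units.val_mul, hP1]
        ext i j
        fin_cases i <;> fin_cases j <;> simp [Matrix.mul_apply, Fin.sum_univ_three]
      · intro h
        rw [h] at hP1
        have := congrFun (congrFun hP1 0) 0
        simp at this
    have h := orderOf_dvd_natCard (⟨P, hmem⟩ : isotropy (crossModel 1 1 1))
    rwa [Subgroup.orderOf_mk, hord] at h
  have h12 : 12 ∣ Nat.card (isotropy (crossModel 1 1 1)) :=
    Nat.Coprime.mul_dvd_of_dvd_of_dvd (by norm_num : Nat.Coprime 4 3) h4 h3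
  have hle := Nat.le_of_dvd Nat.card_pos h12
  have hbij : Function.Bijective ψ := hψ.bijective_of_nat_card_le (by rw [hA4]; exact hle)
  exact ⟨MulEquiv.ofBijective ψ hbij⟩

/-- The new third axis is the threefold axis (1, 1, 1), scaled by -b; the first two columns span the
plane perpendicular to it. Since b is arbitrary, the whole curve is one equivalence class. -/
theorem linearlyEquivalent_crossModel {b : ℝ} (hb : b ≠ 0) :
    LinearlyEquivalent (crossModel 1 1 1) (orderThreeModel (1 / (2 * b)) b 0 (-2 * b)) := by
  have h3 : √(3 : ℝ) * √3 = 3 := Real.mul_self_sqrt (by norm_num)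
  have h3' : √(3 : ℝ) ^ 2 = 3 := Real.sq_sqrt (by norm_num)
  have hdet : (!![1, 0, -b; -1 / 2, √3 / 2, -b; -1 / 2, -√3 / 2, -b] :
      Matrix (Fin 3) (Fin 3) ℝ).det ≠ 0 := by
    have : (!![1, 0, -b; -1 / 2, √3 / 2, -b; -1 / 2, -√3 / 2, -b] :
        Matrix (Fin 3) (Fin 3) ℝ).det = -(3 / 2) * √3 * b := by
      simp [Matrix.det_fin_three]
      ring
    rw [this]
    have : √(3 : ℝ) ≠ 0 := by positivity
    simp [this, hb]
  refine ⟨Matrix.GeneralLinearGroup.mkOfDetNeZero _ hdet, pullback_eq_of_val rfl ?_⟩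
  intro i j k
  fin_cases i <;> fin_cases j <;> fin_cases k <;>
    simp [Fin.sum_univ_three, crossModel, orderThreeModel, ofMatrices, -mul_eq_mul_left_iff,
      -mul_eq_mul_right_iff] <;> (try field_simp) <;> (try ring_nf) <;>
    (try simp only [h3']) <;> (try ring)

/-! ### The structure with isotropy `s₃` -/

/-- The idempotents of the algebra of `orderThreeModel 0 0 1 0`. -/
noncomputable def triangle : Fin 3 → Fin 3 → ℝ :=
  ![![1, 0, 0], ![-1 / 2, √3 / 2, 0], ![-1 / 2, -√3 / 2, 0]]

theorem sqrt_three_pos : 0 < √(3 : ℝ) := by positivity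

theorem triangle_injective : Function.Injective triangle := by
  have h3 := sqrt_three_pos
  intro i j hij
  have h0 := congrFun hij 0
  have h1 := congrFun hij 1
  fin_cases i <;> fin_cases j <;> simp [triangle] at h0 h1 ⊢ <;> linarith

/-- For a = d = 0 products lie in the plane, where the equation is z̄² = z; its non-zero solutions
are the cube roots of unity. -/
theorem idempotent_orderThreeModel_iff (x : Fin 3 → ℝ) :
    (x ≠ 0 ∧ product (orderThreeModel 0 0 1 0) x x = x) ↔ ∃ i, triangle i = x := by
  have h3 : √(3 : ℝ) * √3 = 3 := Real.mul_self_sqrt (by norm_num)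
  constructor
  · rintro ⟨h0, h⟩
    have h1 := congrFun h 0
    have h2 := congrFun h 1
    have h3' := congrFun h 2
    simp [product, orderThreeModel, ofMatrices, Fin.sum_univ_three] at h1 h2 h3'
    have hz : x 2 = 0 := h3'.symm
    rw [hz] at h1 h2
    by_cases hy : x 1 = 0
    · rw [hy] at h1
      have hx : x 0 ≠ 0 := by
        intro hx
        apply h0
        funext i
        fin_cases i <;> simp [hx, hy, hz]
      have hx1 : x 0 = 1 := by apply mul_left_cancel₀ hx; linear_combination h1
      exact ⟨0, by funext i; fin_cases i <;> simp [triangle, hx1, hy, hz]⟩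
    · have hx : x 0 = -1 / 2 := by apply mul_left_cancel₀ hy; linear_combination -h2 / 2
      rw [hx] at h1
      have hyy : (x 1 - √3 / 2) * (x 1 + √3 / 2) = 0 := by
        linear_combination -h1 - h3 / 4
      rcases mul_eq_zero.1 hyy with h | h
      · have : x 1 = √3 / 2 := by linarith
        exact ⟨1, by funext i; fin_cases i <;> simp [triangle, hx, this, hz]⟩
      · have : x 1 = -√3 / 2 := by linarith
        exact ⟨2, by funext i; fin_cases i <;> simp [triangle, hx, this, hz]⟩
  · rintro ⟨i, rfl⟩
    constructor
    · intro h
      have h1 := congrFun h 0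
      fin_cases i <;> simp [triangle] at h1
    · funext k
      fin_cases i <;> fin_cases k <;>
        simp [product, orderThreeModel, ofMatrices, Fin.sum_univ_three, triangle] <;>
        linarith

/-- The rotation of order three about the third axis. -/
noncomputable def rotationThree : GL (Fin 3) ℝ :=
  Matrix.GeneralLinearGroup.mkOfDetNeZero (rotation (-1 / 2) (√3 / 2)) (by
    have h3 : √(3 : ℝ) * √3 = 3 := Real.mul_self_sqrt (by norm_num)
    have : (rotation (-1 / 2) (√3 / 2)).det = 1 := by
      rw [Matrix.det_fin_three]
      simp [rotation]
      linear_combination h3 / 4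
    rw [this]
    exact one_ne_zero)

theorem rotationThree_val : rotationThree.1 = rotation (-1 / 2) (√3 / 2) := rfl

theorem rotationThree_sq_val : (rotationThree ^ 2).1 = rotation (-1 / 2) (-(√3 / 2)) := by
  have h3 : √(3 : ℝ) * √3 = 3 := Real.mul_self_sqrt (by norm_num)
  rw [sq, Units.val_mul, rotationThree_val]
  ext i j
  fin_cases i <;> fin_cases j <;>
    simp [rotation, Matrix.mul_apply, Fin.sum_univ_three] <;> linarith

theorem orderOf_rotationThree : orderOf rotationThree = 3 := by
  have h3 : √(3 : ℝ) * √3 = 3 := Real.mul_self_sqrt (by norm_num)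
  refine orderOf_eq_prime ?_ ?_
  · apply Units.ext
    rw [pow_succ, Units.val_mul, rotationThree_sq_val, rotationThree_val]
    ext i j
    fin_cases i <;> fin_cases j <;>
      simp [rotation, Matrix.mul_apply, Fin.sum_univ_three] <;> linarith
  · intro h
    have := congrArg (fun T : GL (Fin 3) ℝ => T.1 0 0) h
    simp [rotationThree_val, rotation] at this
    norm_num at this

theorem rotationThree_mem (a b c d : ℝ) : rotationThree ∈ isotropy (orderThreeModel a b c d) := by
  have h3 : √(3 : ℝ) * √3 = 3 := Real.mul_self_sqrt (by norm_num)
  refine ⟨?_, pullback_eq_of_val rotationThree_val ?_⟩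
  · change 0 < rotationThree.1.det
    rw [rotationThree_val, Matrix.det_fin_three]
    simp [rotation]
    linarith
  · intro i j k
    fin_cases i <;> fin_cases j <;> fin_cases k <;>
      simp [Fin.sum_univ_three, orderThreeModel, ofMatrices, rotation, -mul_eq_mul_left_iff,
        -mul_eq_mul_right_iff] <;>
      first | ring1 | linear_combination h3 / 4 | linear_combination -h3 / 4 | linear_combination a * h3 / 4

/-- The idempotents span the plane. A symmetry fixing them maps e₃ to the orthogonal line and is 1
by its determinant. Elements of orders 2 and 3 show that all permutations occur. -/
theorem nonempty_mulEquiv_perm :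
    Nonempty (isotropy (orderThreeModel 0 0 1 0) ≃* Equiv.Perm (Fin 3)) := by
  obtain ⟨φ, hφ⟩ := exists_hom_perm triangle_injective idempotent_orderThreeModel_iff
  have hdet : (ricci (orderThreeModel 0 0 1 0)).det ≠ 0 :=
    det_ricci_orderThreeModel (by norm_num) (by norm_num)
  have hinj : Function.Injective φ := by
    rw [injective_iff_map_eq_one]
    rintro ⟨T, hT⟩ hT1
    have h0 := hφ ⟨T, hT⟩ 0
    have h1 := hφ ⟨T, hT⟩ 1
    rw [hT1] at h0 h1
    have hR := fun i j => congrFun (congrFun (ricci_isotropy hT) i) j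
    have hD := det_isotropy hdet hT
    have m00 : T.1 0 0 = 1 := by simpa [triangle, Matrix.mulVec, dotProduct,
      Fin.sum_univ_three] using congrFun h0 0
    have m10 : T.1 1 0 = 0 := by simpa [triangle, Matrix.mulVec, dotProduct,
      Fin.sum_univ_three] using congrFun h0 1
    have m20 : T.1 2 0 = 0 := by simpa [triangle, Matrix.mulVec, dotProduct,
      Fin.sum_univ_three] using congrFun h0 2
    have m01 : T.1 0 1 = 0 := by simpa [triangle, Matrix.mulVec, dotProduct,
      Fin.sum_univ_three, m00] using congrFun h1 0
    have m11 : T.1 1 1 = 1 := by simpa [triangle, Matrix.mulVec, dotProduct,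
      Fin.sum_univ_three, m10] using congrFun h1 1
    have m21 : T.1 2 1 = 0 := by simpa [triangle, Matrix.mulVec, dotProduct,
      Fin.sum_univ_three, m20] using congrFun h1 2
    rw [ricci_orderThreeModel] at hR
    simp only [Matrix.mul_apply, Fin.sum_univ_three, Matrix.transpose_apply] at hR
    have m02 : T.1 0 2 = 0 := by
      have := hR 0 2
      simp [m00, m10, m20] at this
      exact this
    have m12 : T.1 1 2 = 0 := by
      have := hR 1 2
      simp [m01, m11, m21] at this
      exact this
    rw [Matrix.det_fin_three] at hD
    simp [m00, m10, m20, m01, m11, m21] at hD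
    apply Subtype.ext
    apply Units.ext
    ext i j
    fin_cases i <;> fin_cases j <;> simp [m00, m10, m20, m01, m11, m21, m02, m12, hD]
  have hfin : Finite (isotropy (orderThreeModel 0 0 1 0)) := Finite.of_injective φ hinj
  have h3 : 3 ∣ Nat.card (isotropy (orderThreeModel 0 0 1 0)) := by
    have h := orderOf_dvd_natCard
      (⟨rotationThree, rotationThree_mem 0 0 1 0⟩ : isotropy (orderThreeModel 0 0 1 0))
    rwa [Subgroup.orderOf_mk, orderOf_rotationThree] at h
  have h2 : 2 ∣ Nat.card (isotropy (orderThreeModel 0 0 1 0)) := by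
    obtain ⟨F, hF, hF1, hF2⟩ := exists_pullback_of_val (N := Matrix.diagonal ![1, -1, -1])
      (Γ := orderThreeModel 0 0 1 0) (Γ' := orderThreeModel 0 0 1 0)
      (by rw [Matrix.det_diagonal, Fin.prod_univ_three]; simp) (by
        intro i j k
        fin_cases i <;> fin_cases j <;> fin_cases k <;>
          simp [orderThreeModel, ofMatrices, Matrix.diagonal_apply])
    have hmem : F ∈ isotropy (orderThreeModel 0 0 1 0) := ⟨hF, hF2⟩
    have hord : orderOf F = 2 := by
      refine orderOf_eq_prime ?_ ?_
      · apply Units.ext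
        rw [sq, Units.val_mul, hF1, Matrix.diagonal_mul_diagonal]
        ext i j
        fin_cases i <;> fin_cases j <;> simp
      · intro h
        rw [h] at hF1
        have := congrFun (congrFun hF1 1) 1
        norm_num at this
    have h := orderOf_dvd_natCard (⟨F, hmem⟩ : isotropy (orderThreeModel 0 0 1 0))
    rwa [Subgroup.orderOf_mk, hord] at h
  have h6 : 6 ∣ Nat.card (isotropy (orderThreeModel 0 0 1 0)) :=
    Nat.Coprime.mul_dvd_of_dvd_of_dvd (by norm_num : Nat.Coprime 2 3) h2 h3
  have hle := Nat.le_of_dvd Nat.card_pos h6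
  have hbij : Function.Bijective φ := hinj.bijective_of_nat_card_le (by
    rw [Nat.card_perm, Nat.card_fin]
    exact hle)
  exact ⟨MulEquiv.ofBijective φ hbij⟩

/-! ### The third family -/

theorem linearlyEquivalent_perm_model {c : ℝ} (hc : c ≠ 0) :
    LinearlyEquivalent (orderThreeModel 0 0 c 0) (orderThreeModel 0 0 1 0) := by
  have hdet : (Matrix.diagonal ![1, 1, 1 / c]).det ≠ 0 := by
    rw [Matrix.det_diagonal, Fin.prod_univ_three]
    simpa using hc
  refine ⟨Matrix.GeneralLinearGroup.mkOfDetNeZero _ hdet, pullback_eq_of_val rfl ?_⟩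
  intro i j k
  fin_cases i <;> fin_cases j <;> fin_cases k <;>
    simp [orderThreeModel, ofMatrices, Matrix.diagonal_apply, hc]

/-- Places the two exceptional structures on the tetrahedral curve: b = ε/√2 solves 1/(2b) = b. -/
theorem orderThreeModel_exceptional_eq {ε : ℝ} (hε : ε = 1 ∨ ε = -1) :
    orderThreeModel (ε / √2) (ε / √2) 0 (-ε * √2) =
      orderThreeModel (1 / (2 * (ε / √2))) (ε / √2) 0 (-2 * (ε / √2)) := by
  have h2 : √(2 : ℝ) ^ 2 = 2 := Real.sq_sqrt (by norm_num)
  have hε2 : ε ^ 2 = 1 := by rcases hε with rfl | rfl <;> norm_num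
  have hε0 : ε ≠ 0 := by rcases hε with rfl | rfl <;> norm_num
  congr 1
  · field_simp
    rw [h2, hε2]
    ring
  · field_simp
    rw [h2]

theorem div_sqrt_two_ne_zero {ε : ℝ} (hε : ε = 1 ∨ ε = -1) : ε / √2 ≠ 0 := by
  have : √(2 : ℝ) ≠ 0 := by positivity
  rcases hε with rfl | rfl <;> simp

/-- Away from the exceptional structures, the symmetries of the third family fix the third axis. -/
theorem rotation_of_mem_isotropy_orderThreeModel {a b c d : ℝ} (h1 : a * d - 2 ≠ 0)
    (h2 : b * d - b ^ 2 + c ^ 2 ≠ 0) (hs : ¬(a = 0 ∧ b = 0 ∧ d = 0))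
    (ha : ¬(c = 0 ∧ d = -2 * b ∧ 2 * b * a = 1)) {T : GL (Fin 3) ℝ}
    (hT : T ∈ isotropy (orderThreeModel a b c d)) :
    ∃ p q, p ^ 2 + q ^ 2 = 1 ∧ T.1 = rotation p q := by
  have hdet := det_ricci_orderThreeModel h1 h2
  have hW := traceForm_isotropy hT 2
  simp [traceForm, Matrix.trace, rightMul, orderThreeModel, ofMatrices, Fin.sum_univ_three] at hW
  have hR := ricci_isotropy hT
  rw [ricci_orderThreeModel] at hR
  have haxis : T.1 0 2 = 0 ∧ T.1 1 2 = 0 := by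
    by_cases hω : 2 * b + d = 0
    · refine axis_of_commute ?_ (commute_of_cotton hdet (cotton_orderThreeModel a b c d) hT)
      -- For c = 0 and d = -2b, the off-diagonal entry of B is 2b(2ab - 1), which vanishes only on
      -- the excluded tetrahedral curve.
      by_contra! h
      have hc : c = 0 := (mul_eq_zero.1 h.1).resolve_left h1
      have hd : d = -2 * b := by linarith
      have h3 := h.2
      have hb : b ≠ 0 := by
        rintro rfl
        simp [hd, hc] at h2
      refine ha ⟨hc, hd, ?_⟩
      rw [hc, hd] at h3
      apply mul_left_cancel₀ hb
      linear_combination h3 / 2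
    · refine axis_of_traceForm h1 hR ?_
      apply mul_right_cancel₀ hω
      linear_combination hW
  rcases rotation_of_axis h1 (mul_ne_zero two_ne_zero h2) hR (det_isotropy hdet hT) haxis.1
    haxis.2 with h | ⟨p, q, hpq, hM⟩
  · exact h
  -- If the axis is reversed, invariance of Γ_33^3, Γ_11^3 and the trace form gives d = a = b = 0.
  · exfalso
    have e := isotropy_apply_fin hT hM
    have e222 := e 2 2 2
    have e002 := e 0 0 2
    have m22 : T.1 2 2 = -1 := by rw [hM]; simp
    simp [Fin.sum_univ_three, orderThreeModel, ofMatrices] at e222 e002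
    have hd : d = 0 := by linarith
    have ha0 : a = 0 := by linear_combination (e002 - a * hpq) / 2
    rw [m22] at hW
    have hb : b = 0 := by linarith
    exact hs ⟨ha0, hb, hd⟩

/-- A rotation by λ = p + iq preserves z̄ w̄ only if λ̄² = λ, that is λ³ = 1. -/
theorem isotropy_orderThreeModel_eq_zpowers {a b c d : ℝ} (h1 : a * d - 2 ≠ 0)
    (h2 : b * d - b ^ 2 + c ^ 2 ≠ 0) (hs : ¬(a = 0 ∧ b = 0 ∧ d = 0))
    (ha : ¬(c = 0 ∧ d = -2 * b ∧ 2 * b * a = 1)) :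
    isotropy (orderThreeModel a b c d) = Subgroup.zpowers rotationThree := by
  apply le_antisymm
  · intro T hT
    obtain ⟨p, q, hpq, hM⟩ := rotation_of_mem_isotropy_orderThreeModel h1 h2 hs ha hT
    have e := isotropy_apply_fin hT hM
    have e000 := e 0 0 0
    have e001 := e 0 0 1
    simp [Fin.sum_univ_three, orderThreeModel, ofMatrices, rotation] at e000 e001
    have h3 : √(3 : ℝ) * √3 = 3 := Real.mul_self_sqrt (by norm_num)
    by_cases hq : q = 0
    · have hp : p = 1 := by
        rw [hq] at hpq e000
        linear_combination hpq - e000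
      have : T = 1 := by
        apply Units.ext
        rw [hM, hp, hq, rotation]
        ext i j
        fin_cases i <;> fin_cases j <;> simp
      rw [this]
      exact one_mem _
    · have hp : p = -1 / 2 := by
        apply mul_left_cancel₀ hq
        linear_combination -e001 / 2
      have hq2 : (q - √3 / 2) * (q + √3 / 2) = 0 := by
        rw [hp] at hpq
        linear_combination hpq - h3 / 4
      rcases mul_eq_zero.1 hq2 with h | h
      · have : T = rotationThree := by
          apply Units.ext
          rw [hM, rotationThree_val, hp, show q = √3 / 2 by linarith]
        rw [this]
        exact Subgroup.mem_zpowers _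
      · have : T = rotationThree ^ 2 := by
          apply Units.ext
          rw [hM, rotationThree_sq_val, hp, show q = -(√3 / 2) by linarith]
        rw [this]
        exact pow_mem (Subgroup.mem_zpowers _) 2
  · rw [Subgroup.zpowers_le]
    exact rotationThree_mem a b c d

theorem isotropy_orderThreeModel {a b c d : ℝ} (h1 : a * d - 2 ≠ 0)
    (h2 : b * d - b ^ 2 + c ^ 2 ≠ 0) :
    Finite (isotropy (orderThreeModel a b c d)) ∧
    (∃ T ∈ isotropy (orderThreeModel a b c d), orderOf T = 3) ∧
    (LinearlyEquivalent (orderThreeModel a b c d) (orderThreeModel 0 0 1 0) →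
      Nonempty (isotropy (orderThreeModel a b c d) ≃* Equiv.Perm (Fin 3))) ∧
    (∀ ε : ℝ, ε = 1 ∨ ε = -1 →
      LinearlyEquivalent (orderThreeModel a b c d)
        (orderThreeModel (ε / √2) (ε / √2) 0 (-ε * √2)) →
      Nonempty (isotropy (orderThreeModel a b c d) ≃* alternatingGroup (Fin 4))) ∧
    (¬ LinearlyEquivalent (orderThreeModel a b c d) (orderThreeModel 0 0 1 0) →
      (∀ ε : ℝ, ε = 1 ∨ ε = -1 →
        ¬ LinearlyEquivalent (orderThreeModel a b c d)
          (orderThreeModel (ε / √2) (ε / √2) 0 (-ε * √2))) →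
      Nonempty (isotropy (orderThreeModel a b c d) ≃* Multiplicative (ZMod 3))) := by
  have hS3 : LinearlyEquivalent (orderThreeModel a b c d) (orderThreeModel 0 0 1 0) →
      Nonempty (isotropy (orderThreeModel a b c d) ≃* Equiv.Perm (Fin 3)) := by
    intro h
    obtain ⟨f⟩ := h.nonempty_mulEquiv
    obtain ⟨g⟩ := nonempty_mulEquiv_perm
    exact ⟨f.trans g⟩
  have hA4 : ∀ ε : ℝ, ε = 1 ∨ ε = -1 →
      LinearlyEquivalent (orderThreeModel a b c d)
        (orderThreeModel (ε / √2) (ε / √2) 0 (-ε * √2)) →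
      Nonempty (isotropy (orderThreeModel a b c d) ≃* alternatingGroup (Fin 4)) := by
    intro ε hε h
    rw [orderThreeModel_exceptional_eq hε] at h
    obtain ⟨f⟩ :=
      (h.trans (linearlyEquivalent_crossModel (div_sqrt_two_ne_zero hε)).symm).nonempty_mulEquiv
    obtain ⟨g⟩ := nonempty_mulEquiv_crossModel
    exact ⟨f.trans g⟩
  have hZ3 : ¬ LinearlyEquivalent (orderThreeModel a b c d) (orderThreeModel 0 0 1 0) →
      (∀ ε : ℝ, ε = 1 ∨ ε = -1 →
        ¬ LinearlyEquivalent (orderThreeModel a b c d)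
          (orderThreeModel (ε / √2) (ε / √2) 0 (-ε * √2))) →
      Nonempty (isotropy (orderThreeModel a b c d) ≃* Multiplicative (ZMod 3)) := by
    intro hn hn'
    have hs : ¬(a = 0 ∧ b = 0 ∧ d = 0) := by
      rintro ⟨rfl, rfl, rfl⟩
      exact hn (linearlyEquivalent_perm_model fun hc => by simp [hc] at h2)
    have ha : ¬(c = 0 ∧ d = -2 * b ∧ 2 * b * a = 1) := by
      rintro ⟨rfl, rfl, hab⟩
      have hb : b ≠ 0 := by
        rintro rfl
        simp at hab
      have haeq : a = 1 / (2 * b) := by field_simp; linear_combination hab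
      apply hn' 1 (Or.inl rfl)
      rw [orderThreeModel_exceptional_eq (Or.inl rfl), haeq]
      exact (linearlyEquivalent_crossModel hb).symm.trans
        (linearlyEquivalent_crossModel (div_sqrt_two_ne_zero (Or.inl rfl)))
    apply nonempty_mulEquiv_zmod_of_card
    rw [isotropy_orderThreeModel_eq_zpowers h1 h2 hs ha, Nat.card_zpowers, orderOf_rotationThree]
  refine ⟨?_, ⟨rotationThree, rotationThree_mem a b c d, orderOf_rotationThree⟩, hS3, hA4, hZ3⟩
  -- The group is finite because in each case it is isomorphic to s₃, a₄ or ℤ₃.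
  by_cases h : LinearlyEquivalent (orderThreeModel a b c d) (orderThreeModel 0 0 1 0)
  · obtain ⟨f⟩ := hS3 h
    exact Finite.of_equiv _ f.symm.toEquiv
  · by_cases h' : ∃ ε : ℝ, (ε = 1 ∨ ε = -1) ∧
        LinearlyEquivalent (orderThreeModel a b c d)
          (orderThreeModel (ε / √2) (ε / √2) 0 (-ε * √2))
    · obtain ⟨ε, hε, h'⟩ := h'
      obtain ⟨f⟩ := hA4 ε hε h'
      exact Finite.of_equiv _ f.symm.toEquiv
    · push Not at h'
      obtain ⟨f⟩ := hZ3 h h'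
      exact Finite.of_equiv (Multiplicative (ZMod 3)) f.symm.toEquiv

/-! ### The half turn of the fourth family -/

theorem isotropy_orderTwoModel_ne_bot (a b c d e f g h : ℝ) :
    isotropy (orderTwoModel a b c d e f g h) ≠ ⊥ := by
  obtain ⟨P, hP, hP1, hP2⟩ := exists_pullback_of_val (N := Matrix.diagonal ![-1, -1, 1])
    (Γ := orderTwoModel a b c d e f g h) (Γ' := orderTwoModel a b c d e f g h)
    (by rw [Matrix.det_diagonal, Fin.prod_univ_three]; simp) (by
      intro i j k
      fin_cases i <;> fin_cases j <;> fin_cases k <;>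
        simp [orderTwoModel, ofMatrices, Matrix.diagonal_apply])
  rw [Subgroup.ne_bot_iff_exists_ne_one]
  refine ⟨⟨P, hP, hP2⟩, fun hcon => ?_⟩
  have h1 : P = 1 := congrArg Subtype.val hcon
  rw [h1] at hP1
  have := congrFun (congrFun hP1 0) 0
  norm_num at this

end TypeA

theorem theorem1p12 :
    -- every structure with non-trivial isotropy has one of the normal forms
    (∀ Γ : TypeA.Christoffel 3, TypeA.TorsionFree Γ → (TypeA.ricci Γ).det ≠ 0 →
      TypeA.isotropy Γ ≠ ⊥ →
      ∃ T ∈ Matrix.GLPos (Fin 3) ℝ,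
        (∃ a b c d : ℝ, a * d ≠ 0 ∧ -b ^ 2 + b * d + c * (-c + d) ≠ 0 ∧
          TypeA.pullback T Γ = TypeA.hyperbolicModel a b c d) ∨
        (∃ a b c d : ℝ, a * d ≠ 0 ∧ b * d - b ^ 2 + c ^ 2 ≠ 0 ∧
          TypeA.pullback T Γ = TypeA.rotationModel a b c d) ∨
        (∃ a b c d : ℝ, a * d - 2 ≠ 0 ∧ -b ^ 2 + c ^ 2 + b * d ≠ 0 ∧
          TypeA.pullback T Γ = TypeA.orderThreeModel a b c d) ∨
        TypeA.pullback T Γ = TypeA.kleinModel ∨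
        (∃ a b c d e f g h : ℝ,
          (TypeA.ricci (TypeA.orderTwoModel a b c d e f g h)).det ≠ 0 ∧
          TypeA.pullback T Γ = TypeA.orderTwoModel a b c d e f g h ∧
          Nonempty (TypeA.isotropy (TypeA.orderTwoModel a b c d e f g h) ≃*
            Multiplicative (ZMod 2)))) ∧
    -- first family
    (∀ a b c d : ℝ,
      TypeA.ricci (TypeA.hyperbolicModel a b c d) =
        !![0, a * d, 0; a * d, 0, 0; 0, 0, -b ^ 2 + b * d + c * (-c + d)] ∧
      (a * d ≠ 0 → -b ^ 2 + b * d + c * (-c + d) ≠ 0 →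
        (TypeA.isotropy (TypeA.hyperbolicModel a b c d) : Set (GL (Fin 3) ℝ)) = TypeA.SO11)) ∧
    -- second family
    (∀ a b c d : ℝ,
      TypeA.ricci (TypeA.rotationModel a b c d) =
        !![a * d, 0, 0; 0, a * d, 0; 0, 0, 2 * (b * d - b ^ 2 + c ^ 2)] ∧
      (a * d ≠ 0 → b * d - b ^ 2 + c ^ 2 ≠ 0 →
        (TypeA.isotropy (TypeA.rotationModel a b c d) : Set (GL (Fin 3) ℝ)) = TypeA.SO2)) ∧
    -- third family
    (∀ a b c d : ℝ,
      TypeA.ricci (TypeA.orderThreeModel a b c d) =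
        !![a * d - 2, 0, 0; 0, a * d - 2, 0; 0, 0, 2 * (b * d - b ^ 2 + c ^ 2)] ∧
      (a * d - 2 ≠ 0 → -b ^ 2 + c ^ 2 + b * d ≠ 0 →
        Finite (TypeA.isotropy (TypeA.orderThreeModel a b c d)) ∧
        (∃ T ∈ TypeA.isotropy (TypeA.orderThreeModel a b c d), orderOf T = 3) ∧
        (TypeA.LinearlyEquivalent (TypeA.orderThreeModel a b c d)
            (TypeA.orderThreeModel 0 0 1 0) →
          Nonempty (TypeA.isotropy (TypeA.orderThreeModel a b c d) ≃* Equiv.Perm (Fin 3))) ∧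
        (∀ ε : ℝ, ε = 1 ∨ ε = -1 →
          TypeA.LinearlyEquivalent (TypeA.orderThreeModel a b c d)
            (TypeA.orderThreeModel (ε / √2) (ε / √2) 0 (-ε * √2)) →
          Nonempty (TypeA.isotropy (TypeA.orderThreeModel a b c d) ≃*
            alternatingGroup (Fin 4))) ∧
        (¬ TypeA.LinearlyEquivalent (TypeA.orderThreeModel a b c d)
            (TypeA.orderThreeModel 0 0 1 0) →
          (∀ ε : ℝ, ε = 1 ∨ ε = -1 →
            ¬ TypeA.LinearlyEquivalent (TypeA.orderThreeModel a b c d)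
              (TypeA.orderThreeModel (ε / √2) (ε / √2) 0 (-ε * √2))) →
          Nonempty (TypeA.isotropy (TypeA.orderThreeModel a b c d) ≃*
            Multiplicative (ZMod 3))))) ∧
    -- the fourth family
    (TypeA.ricci TypeA.kleinModel = !![-2, 0, 0; 0, 2, 0; 0, 0, 2] ∧
      Nonempty (TypeA.isotropy TypeA.kleinModel ≃* Multiplicative (ZMod 2 × ZMod 2))) ∧
    (∀ a b c d e f g h : ℝ,
      TypeA.ricci (TypeA.orderTwoModel a b c d e f g h) =
        !![-2 * b * d + a * (-c + g + h), -d * e - a * f + b * h, 0;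
           -d * e - a * f + b * h, -2 * b * f + e * (c - g + h), 0;
           0, 0, -c ^ 2 - 2 * d * f + c * h + g * (-g + h)] ∧
      TypeA.isotropy (TypeA.orderTwoModel a b c d e f g h) ≠ ⊥) := by
  refine ⟨fun Γ hΓ hdet hiso => TypeA.exists_normal_form hΓ hdet hiso,
    fun a b c d => ⟨TypeA.ricci_hyperbolicModel a b c d, fun h1 h2 =>
      TypeA.isotropy_hyperbolicModel h1 h2⟩,
    fun a b c d => ⟨TypeA.ricci_rotationModel a b c d, fun h1 h2 =>
      TypeA.isotropy_rotationModel h1 h2⟩,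
    fun a b c d => ⟨TypeA.ricci_orderThreeModel a b c d, fun h1 h2 =>
      TypeA.isotropy_orderThreeModel h1 fun h => h2 (by linear_combination h)⟩,
    ⟨TypeA.ricci_kleinModel, TypeA.nonempty_mulEquiv_kleinModel⟩,
    fun a b c d e f g h => ⟨TypeA.ricci_orderTwoModel a b c d e f g h,
      TypeA.isotropy_orderTwoModel_ne_bot a b c d e f g h⟩⟩
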